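/- Let $q\in\mathbb C$ with $0<|q|<1$, and write $(z)_k=\prod_{i=0}^{k-1}(1-zq^i)$, $(z)_\infty=\prod_{i\ge 0}(1-zq^i)$, $(z_1,\dots,z_t)_k=(z_1)_k\cdots(z_t)_k$ for $k\in\mathbb Z_{\ge0}\cup\{\infty\}$, and $|\boldsymbol k|=k_1+\cdots+k_n$ for $\boldsymbol k=(k_1,\dots,k_n)\in\mathbb Z_{\ge 0}^n$. Let $\alpha,b,c,d,\beta,\gamma,a_1,\dots,a_n,x_1,\dots,x_n$ be complex numbers such that either $$\Big|\frac{a_1\cdots a_n}{q^{n}}\Big|<1,\qquad \Big|\frac{\alpha\beta a_1\cdots a_n}{q^{n}}\Big|<1,\qquad \Big|\frac{\alpha\gamma a_1\cdots a_n}{q^{n}}\Big|<1,$$ or $a_r=q^{N_r}$ with positive integers $N_r$ for $r=1,\dots,n$ (so that the series terminates). Suppose that none of the denominators in the following identity vanishes. Then the sum over $\boldsymbol k$ below converges absolutely, and $$\begin{aligned} &\frac{(\alpha q,\ \alpha a_1\cdots a_n b/q^n,\ \alpha a_1\cdots a_n c/q^n,\ \alpha a_1\cdots a_n d/q^n,\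 \alpha\beta,\ \alpha\gamma)_\infty}{(\alpha a_1\cdots a_n q^{1-n},\ \alpha b,\ \alpha c,\ \alpha d,\ \alpha\beta a_1\cdots a_n/q^n,\ \alpha\gamma a_1\cdots a_n/q^n)_\infty}\\ &=\sum_{k_1,\dots,k_n\ge0}\ \prod_{1\le r<s\le n}\frac{1-q^{k_r-k_s}x_r/x_s}{1-x_r/x_s}\ \prod_{r,s=1}^n\frac{(qx_r/(x_sa_s))_{k_r}}{(qx_r/x_s)_{k_r}}\\ &\quad\times\frac{(1-\alpha q^{2|\boldsymbol k|})(\alpha)_{|\boldsymbol k|}}{(1-\alpha)(\alpha a_1\cdots a_nq^{1-n})_{|\boldsymbol k|}}\,(a_1\cdots a_n)^{|\boldsymbol k|}\,q^{\sum_{r=1}^n(r-1)k_r-n|\boldsymbol k|}\\ &\quad\times\sum_{\substack{0\le m_r\le k_r\\ r=1,\dots,n}}\ \prod_{1\le r<s\le n}\frac{1-q^{m_r-m_s}x_r/x_s}{1-x_r/x_s}\ \prod_{r,s=1}^n\frac{(q^{-k_s}x_r/x_s)_{m_r}}{(qx_r/x_s)_{m_r}}\ \frac{(\alpha q^{|\boldsymbol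 k|},\alpha\beta,\alpha\gamma)_{|\boldsymbol m|}}{(\alpha b,\alpha c,\alpha d)_{|\boldsymbol m|}}\ q^{\sum_{r=1}^n rm_r}. \end{aligned}$$ -/

import Mathlib

noncomputable section

/-- The finite `q`-shifted factorial `(z; q)_k = ∏_{0 ≤ i < k} (1 - z q^i)`. -/
def qPoch (q z : ℂ) (k : ℕ) : ℂ := ∏ i ∈ Finset.range k, (1 - z * q ^ i)

/-- The infinite `q`-shifted factorial `(z; q)_∞ = ∏_{i ≥ 0} (1 - z q^i)` (used for `|q| < 1`). -/
def qPochInf (q z : ℂ) : ℂ := ∏' i : ℕ, (1 - z * q ^ i)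

/-- For `|q| < 1` the infinite product defining `(z; q)_∞` converges, so `∏'` is its value. -/
theorem qPochInf_multipliable {q : ℂ} (hq : ‖q‖ < 1) (z : ℂ) :
    Multipliable fun i : ℕ => 1 - z * q ^ i := by
  have h : Summable fun i : ℕ => ‖-(z * q ^ i)‖ := by
    simpa [norm_mul, norm_pow] using
      (summable_geometric_of_lt_one (norm_nonneg q) hq).mul_left ‖z‖
  simpa [sub_eq_add_neg] using multipliable_one_add_of_summable h

/-- `|k| = k_1 + ⋯ + k_n`. -/
def wt {n : ℕ} (k : Fin n → ℕ) : ℕ := ∑ r, k r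

/-- The factor `∏_{r < s} (1 - q^{k_r - k_s} x_r / x_s) / (1 - x_r / x_s)` which characterizes
`A_n` basic hypergeometric series. -/
def anFactor {n : ℕ} (q : ℂ) (x : Fin n → ℂ) (k : Fin n → ℕ) : ℂ :=
  ∏ r : Fin n, ∏ s ∈ Finset.Ioi r,
    (1 - q ^ ((k r : ℤ) - (k s : ℤ)) * x r / x s) / (1 - x r / x s)

/-- The inner sum, over `0 ≤ m_r ≤ k_r`. The index `r : Fin n` stands for the index `r + 1` of
the usual numbering `1, …, n`. -/
def innerSum {n : ℕ} (q α b c d β γ : ℂ) (x : Fin n → ℂ) (k : Fin n → ℕ) : ℂ :=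
  ∑ m ∈ Fintype.piFinset fun r => Finset.range (k r + 1),
    anFactor q x m
      * (∏ r, ∏ s, qPoch q (q ^ (-(k s : ℤ)) * x r / x s) (m r) / qPoch q (q * x r / x s) (m r))
      * ((qPoch q (α * q ^ wt k) (wt m) * qPoch q (α * β) (wt m) * qPoch q (α * γ) (wt m))
          / (qPoch q (α * b) (wt m) * qPoch q (α * c) (wt m) * qPoch q (α * d) (wt m)))
      * q ^ (∑ r : Fin n, ((r : ℕ) + 1) * m r)

/-- The summand of the outer sum, over `k : Fin n → ℕ`. -/
def outerTerm {n : ℕ} (q α b c d β γ : ℂ) (a x : Fin n → ℂ) (k : Fin n → ℕ) : ℂ :=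
  anFactor q x k
    * (∏ r, ∏ s, qPoch q (q * x r / (x s * a s)) (k r) / qPoch q (q * x r / x s) (k r))
    * (((1 - α * q ^ (2 * wt k)) * qPoch q α (wt k))
        / ((1 - α) * qPoch q (α * (∏ r, a r) * q ^ (1 - (n : ℤ))) (wt k)))
    * (∏ r, a r) ^ wt k
    * q ^ (((∑ r : Fin n, (r : ℕ) * k r : ℕ) : ℤ) - (n : ℤ) * (wt k : ℤ))
    * innerSum q α b c d β γ x k

/-- The quotient of infinite products
`(αq, αAb/qⁿ, αAc/qⁿ, αAd/qⁿ, αβ, αγ)_∞ / (αA q^{1-n}, αb, αc, αd, αβA/qⁿ, αγA/qⁿ)_∞`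
with `A = a_1 ⋯ a_n`. -/
def productSide {n : ℕ} (q α b c d β γ : ℂ) (a : Fin n → ℂ) : ℂ :=
  (qPochInf q (α * q) * qPochInf q (α * (∏ r, a r) * b / q ^ n)
      * qPochInf q (α * (∏ r, a r) * c / q ^ n) * qPochInf q (α * (∏ r, a r) * d / q ^ n)
      * qPochInf q (α * β) * qPochInf q (α * γ))
    / (qPochInf q (α * (∏ r, a r) * q ^ (1 - (n : ℤ))) * qPochInf q (α * b)
      * qPochInf q (α * c) * qPochInf q (α * d)
      * qPochInf q (α * β * (∏ r, a r) / q ^ n) * qPochInf q (α * γ * (∏ r, a r) / q ^ n))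

end

/-! Put `z = a_1⋯a_n / q^n`. Apart from the `A_n` factors, the summands depend on the multi-indices
only through `|k|` and `|m|`, so Milne's fundamental theorem (`sum_milneTerm`) collapses both
multiple sums. The inner sum becomes the `|k|`-th `q`-difference of `φ(m) (αq^{|k|})_m`, where `φ(m)
= (αβ, αγ)_m / (αb, αc, αd)_m` (`innerSum_eq_qDiff`). The outer terms with `|k| = K` then add up to
a single term carrying the Newton-type product `∏_{i<K} (z - q^i)`
(`sum_outerTerm_eq_expansionTerm`).

What remains is an expansion in one variable `z`. At `z = q^L` it terminates and is a Bailey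
inversion (`sum_qDiff_eq`) returning `(αq)_L φ(L)`, the value of the product side. If `a_r =
q^{N_r}`, then `z` is such a point and no analysis is needed. Otherwise both sides, multiplied by
`(αqz)_∞`, are analytic on a disc about `0` and agree at `q^L` for large `L`; these points
accumulate at `0`, so the identity theorem applies (`tsum_expansionTerm`).

Convergence rests on the growth of `q`-differences: those of `φ` are `O(ρ^k)` for every `ρ >
max(|αβ|, |αγ|)` (`exists_norm_qDiff_coeffSeq_le`), by two `q`-Leibniz rules. The Newton products
are `O(R^k)` on `|z| ≤ R`, so a disc with `Rρ < 1` suffices; `|αβz| < 1` and `|αγz| < 1` leave room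
for one containing `z`. -/

open Finset Filter Topology

/-! ### Finite and infinite `q`-shifted factorials: bounds, nonvanishing, analyticity. -/

section QPochhammer

variable {q : ℂ}

theorem qPoch_zero (q z : ℂ) : qPoch q z 0 = 1 := by simp [qPoch]

theorem qPoch_succ (q z : ℂ) (k : ℕ) : qPoch q z (k + 1) = qPoch q z k * (1 - z * q ^ k) := by
  simp [qPoch, prod_range_succ]

theorem qPoch_add (q z : ℂ) (m k : ℕ) :
    qPoch q z (m + k) = qPoch q z m * qPoch q (z * q ^ m) k := by
  simp only [qPoch, prod_range_add, pow_add, mul_assoc]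

theorem qPoch_succ' (q z : ℂ) (k : ℕ) :
    qPoch q z (k + 1) = (1 - z) * qPoch q (z * q) k := by
  rw [add_comm, qPoch_add]
  simp [qPoch]

theorem qPoch_self_ne_zero (hq1 : ‖q‖ < 1) (k : ℕ) : qPoch q q k ≠ 0 := by
  refine prod_ne_zero_iff.2 fun i _ h => ?_
  have h1 : ‖q ^ (i + 1)‖ = 1 := by
    rw [pow_succ', ← sub_eq_zero.1 h, norm_one]
  rw [norm_pow] at h1
  exact absurd h1 (pow_lt_one₀ (norm_nonneg q) hq1 (Nat.succ_ne_zero i)).ne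

theorem tendsto_qPoch (hq1 : ‖q‖ < 1) (z : ℂ) :
    Tendsto (qPoch q z) atTop (𝓝 (qPochInf q z)) :=
  (qPochInf_multipliable hq1 z).hasProd.tendsto_prod_nat

theorem qPochInf_eq_mul (hq1 : ‖q‖ < 1) (z : ℂ) (k : ℕ) :
    qPochInf q z = qPoch q z k * qPochInf q (z * q ^ k) := by
  have h1 : Tendsto (fun j => qPoch q z (j + k)) atTop (𝓝 (qPochInf q z)) :=
    (tendsto_add_atTop_iff_nat k).2 (tendsto_qPoch hq1 z)
  have h2 := (tendsto_qPoch hq1 (z * q ^ k)).const_mul (qPoch q z k)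
  refine tendsto_nhds_unique h1 (h2.congr fun j => ?_)
  rw [add_comm, qPoch_add]

theorem qPoch_ne_zero_of_qPochInf (hq1 : ‖q‖ < 1) {z : ℂ} (h : qPochInf q z ≠ 0) (k : ℕ) :
    qPoch q z k ≠ 0 := fun h0 => h (by rw [qPochInf_eq_mul hq1 z k, h0, zero_mul])

theorem qPochInf_ne_zero_of_qPoch (hq1 : ‖q‖ < 1) {z : ℂ} (h : ∀ k, qPoch q z k ≠ 0) :
    qPochInf q z ≠ 0 := by
  have hs : Summable fun i : ℕ => ‖-(z * q ^ i)‖ := by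
    simpa [norm_mul, norm_pow] using
      (summable_geometric_of_lt_one (norm_nonneg q) hq1).mul_left ‖z‖
  have h1 := tprod_one_add_ne_zero_of_summable (f := fun i : ℕ => -(z * q ^ i)) (fun i => by
    have := h (i + 1)
    rw [qPoch_succ] at this
    simpa [sub_eq_add_neg] using right_ne_zero_of_mul this) hs
  simpa [qPochInf, sub_eq_add_neg] using h1

theorem qPochInf_ne_zero_of_norm_lt_one (hq1 : ‖q‖ < 1) {z : ℂ} (hz : ‖z‖ < 1) :
    qPochInf q z ≠ 0 := by
  refine qPochInf_ne_zero_of_qPoch hq1 fun k => prod_ne_zero_iff.2 fun i _ h => ?_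
  have h1 : ‖z * q ^ i‖ = 1 := by rw [← sub_eq_zero.1 h, norm_one]
  rw [norm_mul, norm_pow] at h1
  have : ‖q‖ ^ i ≤ 1 := pow_le_one₀ (norm_nonneg q) hq1.le
  nlinarith [norm_nonneg z]

theorem prod_one_add_geometric_le {r R : ℝ} (hr0 : 0 ≤ r) (hr1 : r < 1) (hR : 0 ≤ R) (k : ℕ) :
    ∏ i ∈ range k, (1 + R * r ^ i) ≤ Real.exp (R * (1 - r)⁻¹) := by
  refine (Real.prod_one_add_le_exp_sum _ fun i => by positivity).trans (Real.exp_le_exp.2 ?_)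
  rw [← mul_sum]
  refine mul_le_mul_of_nonneg_left ?_ hR
  rw [← tsum_geometric_of_lt_one hr0 hr1]
  exact (summable_geometric_of_lt_one hr0 hr1).sum_le_tsum _ fun i _ => by positivity

theorem norm_qPoch_le (hq1 : ‖q‖ < 1) {z : ℂ} {R : ℝ} (hz : ‖z‖ ≤ R) (k : ℕ) :
    ‖qPoch q z k‖ ≤ Real.exp (R * (1 - ‖q‖)⁻¹) := by
  have hR := (norm_nonneg z).trans hz
  refine le_trans ?_ (prod_one_add_geometric_le (norm_nonneg q) hq1 hR k)
  rw [qPoch, norm_prod]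
  refine prod_le_prod (fun i _ => norm_nonneg _) fun i _ => ?_
  calc ‖1 - z * q ^ i‖ ≤ ‖(1 : ℂ)‖ + ‖z * q ^ i‖ := norm_sub_le _ _
    _ ≤ 1 + R * ‖q‖ ^ i := by rw [norm_one, norm_mul, norm_pow]; gcongr

theorem norm_qPochInf_le (hq1 : ‖q‖ < 1) {z : ℂ} {R : ℝ} (hz : ‖z‖ ≤ R) :
    ‖qPochInf q z‖ ≤ Real.exp (R * (1 - ‖q‖)⁻¹) :=
  le_of_tendsto (tendsto_qPoch hq1 z).norm (Eventually.of_forall fun k => norm_qPoch_le hq1 hz k)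

theorem exists_norm_inv_qPoch_le (hq1 : ‖q‖ < 1) {z : ℂ} (h : qPochInf q z ≠ 0) :
    ∃ C, 0 < C ∧ ∀ k, ‖(qPoch q z k)⁻¹‖ ≤ C := by
  obtain ⟨C, hC0, hC⟩ := (Metric.isBounded_range_of_tendsto _
    ((tendsto_qPoch hq1 z).inv₀ h)).exists_pos_norm_le
  exact ⟨C, hC0, fun k => hC _ ⟨k, rfl⟩⟩

theorem qPochInf_self_ne_zero (hq1 : ‖q‖ < 1) : qPochInf q q ≠ 0 :=
  qPochInf_ne_zero_of_norm_lt_one hq1 hq1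

/-- On each ball the factors are `1 + O(|q|^i)` uniformly, so the partial products converge locally
uniformly. -/
theorem differentiable_qPochInf (hq1 : ‖q‖ < 1) : Differentiable ℂ (qPochInf q) := by
  intro z
  have hU : IsOpen (Metric.ball (0 : ℂ) (‖z‖ + 1)) := Metric.isOpen_ball
  have h := ((summable_geometric_of_lt_one (norm_nonneg q) hq1).mul_left
    (‖z‖ + 1)).hasProdLocallyUniformlyOn_nat_one_add hU (f := fun (i : ℕ) (w : ℂ) => -(w * q ^ i))
    (Eventually.of_forall fun i w hw => by
      rw [mem_ball_zero_iff] at hw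
      rw [norm_neg, norm_mul, norm_pow]
      gcongr)
    (fun i => by fun_prop)
  have h' := h.differentiableOn
    (Eventually.of_forall fun k => by
      simpa [Finset.prod_fn] using DifferentiableOn.fun_finsetProd fun i _ => by fun_prop) hU
  have hz : Metric.ball (0 : ℂ) (‖z‖ + 1) ∈ 𝓝 z :=
    hU.mem_nhds (by simp)
  refine (h'.differentiableAt hz).congr_of_eventuallyEq (Eventually.of_forall fun w => ?_)
  simp [qPochInf, sub_eq_add_neg]

end QPochhammer

/-! ### `q`-differences and their Leibniz rules. -/

section QDifference

variable {q : ℂ}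

/-- The `q`-binomial coefficient, defined by Pascal's rule. -/
def qBinom (q : ℂ) : ℕ → ℕ → ℂ
  | _, 0 => 1
  | 0, _ + 1 => 0
  | k + 1, j + 1 => qBinom q k j + q ^ (j + 1) * qBinom q k (j + 1)

theorem qBinom_zero_right (q : ℂ) (k : ℕ) : qBinom q k 0 = 1 := by cases k <;> rfl

theorem qBinom_eq_zero (q : ℂ) : ∀ {k j : ℕ}, k < j → qBinom q k j = 0
  | 0, j + 1, _ => rfl
  | k + 1, j + 1, h => by
    rw [qBinom, qBinom_eq_zero q (by omega), qBinom_eq_zero q (by omega)]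
    ring

theorem qBinom_mul_qPoch (q : ℂ) (i j : ℕ) :
    qBinom q (i + j) i * (qPoch q q i * qPoch q q j) = qPoch q q (i + j) := by
  induction i generalizing j with
  | zero => simp [qBinom_zero_right, qPoch_zero]
  | succ i IH =>
    induction j with
    | zero =>
      have h := IH 0
      simp only [add_zero, qPoch_zero, mul_one] at h ⊢
      rw [qBinom, qBinom_eq_zero q (Nat.lt_succ_self i), qPoch_succ]
      linear_combination (1 - q * q ^ i) * h
    | succ j IH2 =>
      have h := IH (j + 1)
      have e : i + 1 + (j + 1) = (i + (j + 1)) + 1 := by omega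
      have e2 : i + 1 + j = i + (j + 1) := by omega
      rw [e2] at IH2
      rw [e, qBinom, qPoch_succ q q (i + (j + 1))]
      calc _ = (qBinom q (i + (j + 1)) i * (qPoch q q i * qPoch q q (j + 1))) * (1 - q * q ^ i)
            + q ^ (i + 1) * (1 - q * q ^ j)
              * (qBinom q (i + (j + 1)) (i + 1) * (qPoch q q (i + 1) * qPoch q q j)) := by
              rw [qPoch_succ q q i, qPoch_succ q q j]; ring
        _ = _ := by rw [h, IH2]; ring

/-- Pascal's rule in summed form; it drives the induction step of both Leibniz rules. -/
theorem sum_qBinom_succ (q : ℂ) (k : ℕ) (c : ℕ → ℂ) :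
    ∑ j ∈ range (k + 2), qBinom q (k + 1) j * c j
      = ∑ j ∈ range (k + 1), qBinom q k j * (c (j + 1) + q ^ j * c j) := by
  rw [sum_range_succ']
  have h : ∑ j ∈ range (k + 1), qBinom q k j * (q ^ j * c j)
      = ∑ j ∈ range (k + 1), qBinom q k (j + 1) * (q ^ (j + 1) * c (j + 1)) + c 0 := by
    have := sum_range_succ (fun j => qBinom q k j * (q ^ j * c j)) (k + 1)
    rw [qBinom_eq_zero q (Nat.lt_succ_self k), zero_mul, add_zero] at this
    rw [← this, sum_range_succ']
    simp [qBinom_zero_right]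
  simp only [mul_add, sum_add_distrib]
  rw [h, qBinom_zero_right, one_mul, ← add_assoc, ← sum_add_distrib]
  congr 1
  refine sum_congr rfl fun j _ => ?_
  rw [qBinom]; ring

/-- For `|q| < 1` a `q`-binomial coefficient is a quotient of partial products with nonzero limits,
hence bounded, unlike ordinary binomials. The Leibniz rules therefore cost no exponential factor. -/
theorem exists_norm_qBinom_le (hq1 : ‖q‖ < 1) :
    ∃ C, 0 < C ∧ ∀ k j, ‖qBinom q k j‖ ≤ C := by
  obtain ⟨D, hD0, hD⟩ := exists_norm_inv_qPoch_le hq1 (qPochInf_self_ne_zero hq1)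
  refine ⟨Real.exp (1 * (1 - ‖q‖)⁻¹) * (D * D), by positivity, fun k j => ?_⟩
  rcases lt_or_ge k j with h | h
  · rw [qBinom_eq_zero q h, norm_zero]; positivity
  · obtain ⟨i, rfl⟩ := Nat.exists_eq_add_of_le h
    have h1 := qBinom_mul_qPoch q j i
    have hj := qPoch_self_ne_zero hq1 j
    have hi := qPoch_self_ne_zero hq1 i
    have : qBinom q (j + i) j = qPoch q q (j + i) * ((qPoch q q j)⁻¹ * (qPoch q q i)⁻¹) := by
      rw [← h1]; field_simp
    rw [this, norm_mul, norm_mul]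
    gcongr
    exacts [norm_qPoch_le hq1 hq1.le _, hD j, hD i]

/-- The `k`-th `q`-difference of a sequence at the nodes `1, q, …, q ^ k`. It is `(q; q)_k` times
the divided difference at these nodes. -/
noncomputable def qDiff (q : ℂ) (k : ℕ) (f : ℕ → ℂ) : ℂ :=
  ∑ m ∈ range (k + 1), qPoch q (q ^ (-(k : ℤ))) m / qPoch q q m * q ^ m * f m

theorem qDiff_zero (q : ℂ) (f : ℕ → ℂ) : qDiff q 0 f = f 0 := by
  simp [qDiff, qPoch_zero]

theorem qDiff_const_mul (q : ℂ) (k : ℕ) (c : ℂ) (f : ℕ → ℂ) :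
    qDiff q k (fun m => c * f m) = c * qDiff q k f := by
  simp only [qDiff, mul_sum]
  exact sum_congr rfl fun m _ => by ring

theorem qPoch_zpow_neg_eq_zero (hq0 : q ≠ 0) {k m : ℕ} (h : k < m) :
    qPoch q (q ^ (-(k : ℤ))) m = 0 := by
  refine prod_eq_zero (mem_range.2 h) ?_
  rw [← zpow_natCast q k, ← zpow_add₀ hq0]
  simp

theorem qPoch_zpow_neg_succ (hq0 : q ≠ 0) (k m : ℕ) :
    qPoch q (q ^ (-((k + 1 : ℕ) : ℤ))) (m + 1)
      = (1 - (q ^ (k + 1))⁻¹) * qPoch q (q ^ (-(k : ℤ))) m := by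
  rw [qPoch_succ']
  congr 2
  rw [zpow_neg, zpow_natCast, zpow_neg, zpow_natCast, pow_succ]; field_simp

/-- The `k`-th difference operator factors as `∏_{i<k} (1 - q^{-i} S)`, with `S` the shift; this
peels off the last factor. -/
theorem qDiff_succ (hq0 : q ≠ 0) (hq1 : ‖q‖ < 1) (k : ℕ) (f : ℕ → ℂ) :
    qDiff q (k + 1) f = qDiff q k f - (q ^ k)⁻¹ * qDiff q k (fun m => f (m + 1)) := by
  -- The added term `m = k + 1` vanishes; it gives all sums the same range.
  have h : qDiff q k f = ∑ m ∈ range (k + 1 + 1),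
      qPoch q (q ^ (-(k : ℤ))) m / qPoch q q m * q ^ m * f m := by
    rw [sum_range_succ, qPoch_zpow_neg_eq_zero hq0 (Nat.lt_succ_self k), qDiff]
    ring
  rw [h, qDiff, sum_range_succ', sum_range_succ' _ (k + 1), qDiff, mul_sum, add_sub_right_comm,
    ← sum_sub_distrib]
  congr 1
  · refine sum_congr rfl fun m _ => ?_
    rw [qPoch_zpow_neg_succ hq0, qPoch_succ q (q ^ (-(k : ℤ))) m]
    have h1 := qPoch_self_ne_zero hq1 m
    have h2 := qPoch_self_ne_zero hq1 (m + 1)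
    rw [qPoch_succ] at h2 ⊢
    have h3 := right_ne_zero_of_mul h2
    rw [zpow_neg, zpow_natCast]
    generalize qPoch q (q ^ k)⁻¹ m = P
    generalize qPoch q q m = Q at *
    field_simp
    ring

/-- A `q`-Leibniz rule. For `f = 1` only `j = 0` survives, which is the `q`-Chu–Vandermonde
evaluation `u^k`. -/
theorem qDiff_mul_qPoch (hq0 : q ≠ 0) (hq1 : ‖q‖ < 1) (k : ℕ) (f : ℕ → ℂ) (u : ℂ) :
    qDiff q k (fun m => f m * qPoch q u m)
      = ∑ j ∈ range (k + 1), qBinom q k j * (qDiff q j f * qPoch q u j * u ^ (k - j)) := by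
  induction k generalizing f u with
  | zero => simp [qDiff_zero, qPoch_zero, qBinom]
  | succ k IH =>
    have h : (fun m => f (m + 1) * qPoch q u (m + 1))
        = fun m => (1 - u) * (f (m + 1) * qPoch q (u * q) m) := by
      funext m; rw [qPoch_succ']; ring
    rw [qDiff_succ hq0 hq1, h, qDiff_const_mul, IH, IH (fun m => f (m + 1)), sum_qBinom_succ,
      mul_sum, mul_sum, ← sum_sub_distrib]
    refine sum_congr rfl fun j hj => ?_
    have hj : j ≤ k := Nat.lt_succ_iff.1 (mem_range.1 hj)
    obtain ⟨l, rfl⟩ := Nat.exists_eq_add_of_le hj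
    rw [show j + l + 1 - (j + 1) = l by omega, show j + l + 1 - j = l + 1 by omega,
      show j + l - j = l by omega, qDiff_succ hq0 hq1 j f]
    have e : (1 - u) * qPoch q (u * q) j = qPoch q u j * (1 - u * q ^ j) := by
      rw [← qPoch_succ', qPoch_succ]
    generalize qDiff q j (fun m => f (m + 1)) = X
    have hql : q ^ (j + l) ≠ 0 := pow_ne_zero _ hq0
    have e2 : (q ^ (j + l))⁻¹ * ((1 - u) * (qBinom q (j + l) j *
        (X * qPoch q (u * q) j * (u * q) ^ l)))
        = (q ^ j)⁻¹ * qBinom q (j + l) j * X * ((1 - u) * qPoch q (u * q) j) * u ^ l := by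
      rw [mul_pow, pow_add]; field_simp
    rw [e2, e, qPoch_succ]
    field_simp
    ring

/-- The companion rule for division. The Gaussian factor `q^{(k-j choose 2)}` later makes division
harmless for growth. -/
theorem qDiff_div_qPoch (hq0 : q ≠ 0) (hq1 : ‖q‖ < 1) (k : ℕ) (f : ℕ → ℂ) {v : ℂ}
    (hv : ∀ m, qPoch q v m ≠ 0) :
    qDiff q k (fun m => f m * (qPoch q v m)⁻¹)
      = (qPoch q v k)⁻¹ * ∑ j ∈ range (k + 1),
          qBinom q k j * (qDiff q j f * ((-v) ^ (k - j) * q ^ (k - j).choose 2)) := by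
  induction k generalizing f v with
  | zero => simp [qDiff_zero, qPoch_zero, qBinom]
  | succ k IH =>
    have hv1 : 1 - v ≠ 0 := by simpa [qPoch_succ, qPoch_zero] using hv 1
    have hvq : ∀ m, qPoch q (v * q) m ≠ 0 := fun m => by
      have := hv (m + 1)
      rw [qPoch_succ'] at this
      exact right_ne_zero_of_mul this
    have h : (fun m => f (m + 1) * (qPoch q v (m + 1))⁻¹)
        = fun m => (1 - v)⁻¹ * (f (m + 1) * (qPoch q (v * q) m)⁻¹) := by
      funext m; rw [qPoch_succ', mul_inv]; ring
    have e : (qPoch q v (k + 1))⁻¹ = (1 - v)⁻¹ * (qPoch q (v * q) k)⁻¹ := by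
      rw [qPoch_succ', mul_inv]
    have e' : (qPoch q v k)⁻¹ = (qPoch q v (k + 1))⁻¹ * (1 - v * q ^ k) := by
      have := hv (k + 1)
      rw [qPoch_succ] at this ⊢
      have h2 := right_ne_zero_of_mul this
      rw [mul_inv, mul_assoc, inv_mul_cancel₀ h2, mul_one]
    rw [qDiff_succ hq0 hq1, h, qDiff_const_mul, IH f hv, IH (fun m => f (m + 1)) hvq,
      sum_qBinom_succ, e', e]
    have e3 : ∀ S T U a b : ℂ, U = b * S - a * T → ∀ p r : ℂ,
        p * r * b * S - a * (p * (r * T)) = p * r * U := by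
      rintro S T U a b rfl p r; ring
    refine e3 _ _ _ _ _ ?_ _ _
    rw [mul_sum, mul_sum, ← sum_sub_distrib]
    refine sum_congr rfl fun j hj => ?_
    have hj : j ≤ k := Nat.lt_succ_iff.1 (mem_range.1 hj)
    obtain ⟨l, rfl⟩ := Nat.exists_eq_add_of_le hj
    rw [show j + l + 1 - (j + 1) = l by omega, show j + l + 1 - j = l + 1 by omega,
      show j + l - j = l by omega, qDiff_succ hq0 hq1 j f,
      show (l + 1).choose 2 = l + l.choose 2 by rw [Nat.choose_succ_succ, Nat.choose_one_right]]
    generalize qDiff q j (fun m => f (m + 1)) = X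
    rw [show -(v * q) = -v * q by ring, mul_pow, pow_add, pow_add, pow_succ]
    field_simp
    ring

end QDifference

/-! ### Exponential bounds for `q`-differences. -/

section Growth

variable {q : ℂ}

theorem qDiff_one (hq0 : q ≠ 0) (hq1 : ‖q‖ < 1) (k : ℕ) :
    qDiff q (k + 1) (fun _ => 1) = 0 := by
  induction k with
  | zero => simp [qDiff_succ hq0 hq1, qDiff_zero]
  | succ k IH => rw [qDiff_succ hq0 hq1, IH]; simp

/-- If the `q`-differences of `g` are bounded by a convolution of those of `f` with a rapidly
decreasing sequence, then exponential growth of the former follows from that of the latter. -/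
theorem exists_bound_of_convolution {D E : ℕ → ℂ} {w : ℕ → ℝ} {ρ C₁ : ℝ} (hρ : 0 < ρ)
    (hC₁ : 0 ≤ C₁) (hw0 : ∀ l, 0 ≤ w l) (hw : Summable fun l => w l / ρ ^ l)
    (h : ∀ k, ‖E k‖ ≤ C₁ * ∑ j ∈ range (k + 1), ‖D j‖ * w (k - j))
    (hD : ∃ C, ∀ k, ‖D k‖ ≤ C * ρ ^ k) : ∃ C, ∀ k, ‖E k‖ ≤ C * ρ ^ k := by
  obtain ⟨C, hC⟩ := hD
  have hC0 : 0 ≤ C := by simpa using (norm_nonneg _).trans (hC 0)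
  refine ⟨C₁ * (C * ∑' l, w l / ρ ^ l), fun k => (h k).trans ?_⟩
  rw [mul_assoc, mul_assoc]
  refine mul_le_mul_of_nonneg_left ?_ hC₁
  calc ∑ j ∈ range (k + 1), ‖D j‖ * w (k - j)
      ≤ ∑ j ∈ range (k + 1), C * ρ ^ k * (w (k - j) / ρ ^ (k - j)) := by
        refine sum_le_sum fun j hj => ?_
        obtain ⟨l, rfl⟩ := Nat.exists_eq_add_of_le (Nat.lt_succ_iff.1 (mem_range.1 hj))
        rw [Nat.add_sub_cancel_left]
        calc ‖D j‖ * w l ≤ C * ρ ^ j * w l := mul_le_mul_of_nonneg_right (hC j) (hw0 l)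
          _ = _ := by rw [pow_add]; field_simp
    _ = C * ρ ^ k * ∑ l ∈ range (k + 1), w l / ρ ^ l := by
        rw [← mul_sum, ← sum_range_reflect (fun l => w l / ρ ^ l)]
        simp
    _ ≤ C * ρ ^ k * ∑' l, w l / ρ ^ l := by
        refine mul_le_mul_of_nonneg_left ?_ (by positivity)
        exact hw.sum_le_tsum _ fun l _ => div_nonneg (hw0 l) (by positivity)
    _ = _ := by ring

theorem summable_pow_mul_pow_choose_two {r s : ℝ} (hr0 : 0 ≤ r) (hr1 : r < 1) (hs : 0 ≤ s) :
    Summable fun l : ℕ => s ^ l * r ^ l.choose 2 := by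
  refine summable_of_ratio_norm_eventually_le (r := 1 / 2) (by norm_num) ?_
  have ht : Tendsto (fun l : ℕ => s * r ^ l) atTop (𝓝 (s * 0)) :=
    (tendsto_pow_atTop_nhds_zero_of_lt_one hr0 hr1).const_mul s
  rw [mul_zero] at ht
  filter_upwards [ht.eventually_le_const (show (0 : ℝ) < 1 / 2 by norm_num)] with l hl
  rw [Real.norm_of_nonneg (by positivity), Real.norm_of_nonneg (by positivity),
    Nat.choose_succ_succ, Nat.choose_one_right, pow_succ, pow_add]
  calc s ^ l * s * (r ^ l * r ^ l.choose 2) = s * r ^ l * (s ^ l * r ^ l.choose 2) := by ring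
    _ ≤ _ := by gcongr

/-- The Leibniz weights are `|u|^l`; their summability against `ρ^{-l}` is what forces `|u| < ρ`. -/
theorem exists_norm_qDiff_mul_qPoch_le (hq0 : q ≠ 0) (hq1 : ‖q‖ < 1) {f : ℕ → ℂ} {u : ℂ} {ρ : ℝ}
    (hu : ‖u‖ < ρ) (hf : ∃ C, ∀ k, ‖qDiff q k f‖ ≤ C * ρ ^ k) :
    ∃ C, ∀ k, ‖qDiff q k (fun m => f m * qPoch q u m)‖ ≤ C * ρ ^ k := by
  have hρ : 0 < ρ := (norm_nonneg u).trans_lt hu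
  obtain ⟨B, hB0, hB⟩ := exists_norm_qBinom_le hq1
  refine exists_bound_of_convolution (w := fun l => ‖u‖ ^ l)
    (C₁ := B * Real.exp (‖u‖ * (1 - ‖q‖)⁻¹)) hρ (by positivity) (fun l => by positivity)
    ?_ (fun k => ?_) hf
  · simp only [← div_pow]
    exact summable_geometric_of_lt_one (by positivity) ((div_lt_one hρ).2 hu)
  · rw [qDiff_mul_qPoch hq0 hq1, mul_sum]
    refine norm_sum_le_of_le _ fun j _ => ?_
    rw [norm_mul, norm_mul, norm_mul, norm_pow]
    calc _ ≤ B * (‖qDiff q j f‖ * Real.exp (‖u‖ * (1 - ‖q‖)⁻¹) * ‖u‖ ^ (k - j)) := by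
          gcongr
          exacts [hB _ _, norm_qPoch_le hq1 le_rfl _]
      _ = _ := by ring

/-- The weights decay like `|q|^{l²/2}`, so no comparison of `|v|` with `ρ` is needed. -/
theorem exists_norm_qDiff_div_qPoch_le (hq0 : q ≠ 0) (hq1 : ‖q‖ < 1) {f : ℕ → ℂ} {v : ℂ} {ρ : ℝ}
    (hρ : 0 < ρ) (hv : qPochInf q v ≠ 0) (hf : ∃ C, ∀ k, ‖qDiff q k f‖ ≤ C * ρ ^ k) :
    ∃ C, ∀ k, ‖qDiff q k (fun m => f m * (qPoch q v m)⁻¹)‖ ≤ C * ρ ^ k := by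
  obtain ⟨B, hB0, hB⟩ := exists_norm_qBinom_le hq1
  obtain ⟨V, hV0, hV⟩ := exists_norm_inv_qPoch_le hq1 hv
  refine exists_bound_of_convolution (w := fun l => ‖v‖ ^ l * ‖q‖ ^ l.choose 2)
    (C₁ := V * B) hρ (by positivity) (fun l => by positivity) ?_ (fun k => ?_) hf
  · refine (summable_pow_mul_pow_choose_two (norm_nonneg q) hq1
      (show 0 ≤ ‖v‖ / ρ by positivity)).congr fun l => ?_
    rw [div_pow]; ring
  · rw [qDiff_div_qPoch hq0 hq1 k f (qPoch_ne_zero_of_qPochInf hq1 hv), norm_mul, mul_assoc]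
    refine mul_le_mul (hV k) ?_ (norm_nonneg _) hV0.le
    rw [mul_sum]
    refine norm_sum_le_of_le _ fun j _ => ?_
    rw [norm_mul, norm_mul, norm_mul, norm_pow, norm_pow, norm_neg]
    gcongr
    exact hB _ _

/-- Here the parameter shrinks with the order `k`, so its powers decay fast enough to impose no
condition relating `α` and `ρ`. -/
theorem exists_norm_qDiff_mul_qPoch_pow_le (hq0 : q ≠ 0) (hq1 : ‖q‖ < 1) {f : ℕ → ℂ} (α : ℂ)
    {ρ : ℝ} (hρ : 0 < ρ) (hf : ∃ C, ∀ k, ‖qDiff q k f‖ ≤ C * ρ ^ k) :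
    ∃ C, ∀ k, ‖qDiff q k (fun m => f m * qPoch q (α * q ^ k) m)‖ ≤ C * ρ ^ k := by
  obtain ⟨B, hB0, hB⟩ := exists_norm_qBinom_le hq1
  refine exists_bound_of_convolution (w := fun l => ‖α‖ ^ l * ‖q‖ ^ l.choose 2)
    (C₁ := B * Real.exp (‖α‖ * (1 - ‖q‖)⁻¹)) hρ (by positivity) (fun l => by positivity)
    ?_ (fun k => ?_) hf
  · refine (summable_pow_mul_pow_choose_two (norm_nonneg q) hq1
      (show 0 ≤ ‖α‖ / ρ by positivity)).congr fun l => ?_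
    rw [div_pow]; ring
  · have hle : ‖α * q ^ k‖ ≤ ‖α‖ := by
      rw [norm_mul, norm_pow]
      exact mul_le_of_le_one_right (norm_nonneg α) (pow_le_one₀ (norm_nonneg q) hq1.le)
    rw [qDiff_mul_qPoch hq0 hq1, mul_sum]
    refine norm_sum_le_of_le _ fun j _ => ?_
    rw [norm_mul, norm_mul, norm_mul, norm_pow]
    -- With `l = k - j ≤ k`, the exponent `kl` dominates `l(l-1)/2`.
    have hpow : ‖α * q ^ k‖ ^ (k - j) ≤ ‖α‖ ^ (k - j) * ‖q‖ ^ (k - j).choose 2 := by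
      rw [norm_mul, norm_pow, mul_pow, ← pow_mul]
      refine mul_le_mul_of_nonneg_left ?_ (by positivity)
      refine pow_le_pow_of_le_one (norm_nonneg q) hq1.le ?_
      rw [Nat.choose_two_right]
      calc (k - j) * (k - j - 1) / 2 ≤ (k - j) * (k - j - 1) := Nat.div_le_self _ _
        _ ≤ k * (k - j) := Nat.mul_comm k _ ▸ Nat.mul_le_mul_left _ (by omega)
    calc _ ≤ B * (‖qDiff q j f‖ * Real.exp (‖α‖ * (1 - ‖q‖)⁻¹)
            * (‖α‖ ^ (k - j) * ‖q‖ ^ (k - j).choose 2)) := by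
          gcongr
          exacts [hB _ _, norm_qPoch_le hq1 hle _]
      _ = _ := by ring

end Growth

/-! ### Bailey inversion. -/

section Inversion

variable {q : ℂ}

theorem qPoch_zpow_neg_succ_mul (hq0 : q ≠ 0) (k m : ℕ) :
    qPoch q (q ^ (-((k + 1 : ℕ) : ℤ))) m * (q ^ m - q ^ (k + 1))
      = qPoch q (q ^ (-(k : ℤ))) m * (1 - q ^ (k + 1)) := by
  have h1 := qPoch_zpow_neg_succ hq0 k m
  rw [qPoch_succ] at h1
  have hz : q ^ (-((k + 1 : ℕ) : ℤ)) = (q ^ (k + 1))⁻¹ := by rw [zpow_neg, zpow_natCast]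
  have hk : q ^ (k + 1) ≠ 0 := pow_ne_zero _ hq0
  generalize qPoch q (q ^ (-((k + 1 : ℕ) : ℤ))) m = X at *
  generalize qPoch q (q ^ (-(k : ℤ))) m = Y at *
  rw [hz] at h1
  field_simp at h1
  linear_combination -h1

/-- Evaluates the only surviving term, `k = m = L`, of the orthogonality sum below. -/
theorem prod_pow_sub_pow_mul_qPoch (hq0 : q ≠ 0) (L : ℕ) :
    (∏ i ∈ range L, (q ^ L - q ^ i)) * qPoch q (q ^ (-(L : ℤ))) L * q ^ L = qPoch q q L ^ 2 := by
  induction L with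
  | zero => simp [qPoch_zero]
  | succ L IH =>
    have h : ∏ i ∈ range L, (q ^ (L + 1) - q ^ (i + 1)) = q ^ L * ∏ i ∈ range L, (q ^ L - q ^ i) := by
      have : ∀ i ∈ range L, q ^ (L + 1) - q ^ (i + 1) = q * (q ^ L - q ^ i) := fun i _ => by ring
      rw [prod_congr rfl this, prod_mul_distrib, prod_const, card_range]
    rw [prod_range_succ', h, qPoch_zpow_neg_succ hq0, qPoch_succ]
    have hL : q ^ L ≠ 0 := pow_ne_zero _ hq0
    calc _ = ((∏ i ∈ range L, (q ^ L - q ^ i)) * qPoch q (q ^ (-(L : ℤ))) L * q ^ L)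
          * (q * (q ^ (L + 1) - q ^ 0) * (1 - (q ^ (L + 1))⁻¹)) * q ^ L := by ring
      _ = _ := by rw [IH]; field_simp; ring

/-- Orthogonality relation underlying the Bailey inversion. -/
theorem sum_bailey_eq (hq0 : q ≠ 0) (hq1 : ‖q‖ < 1) (α : ℂ) {L m : ℕ} (hm : m ≤ L)
    (hα : ∀ k, qPoch q (α * q ^ (L + 1)) k ≠ 0) :
    ∑ k ∈ range (L + 1), (∏ i ∈ range k, (q ^ L - q ^ i)) / qPoch q q k
        * ((1 - α * q ^ (2 * k)) * qPoch q α k / qPoch q (α * q ^ (L + 1)) k)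
        * (qPoch q (q ^ (-(k : ℤ))) m / qPoch q q m * q ^ m * qPoch q (α * q ^ k) m)
      = if m = L then qPoch q α (L + 1) else 0 := by
  split_ifs with hmL
  · subst hmL
    rw [sum_eq_single_of_mem m (by simp) fun k hk hkm => by
      rw [qPoch_zpow_neg_eq_zero hq0 (by rw [mem_range] at hk; omega)]; ring]
    have h1 := prod_pow_sub_pow_mul_qPoch hq0 m
    have h2 := qPoch_self_ne_zero hq1 m
    have h3 : qPoch q α m * qPoch q (α * q ^ m) m * (1 - α * q ^ (2 * m))
        = qPoch q α (m + 1) * qPoch q (α * q ^ (m + 1)) m := by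
      rw [← qPoch_add, ← qPoch_add, show m + 1 + m = m + m + 1 by omega, qPoch_succ, two_mul]
    have h4 := hα m
    generalize qPoch q (q ^ (-(m : ℤ))) m = X at *
    field_simp
    calc _ = ((∏ i ∈ range m, (q ^ m - q ^ i)) * X * q ^ m)
          * (qPoch q α m * qPoch q (α * q ^ m) m * (1 - α * q ^ (2 * m))) := by ring_nf
      _ = _ := by rw [h1, h3]; ring
  · have hlt : m < L := lt_of_le_of_ne hm hmL
    -- A telescoping certificate: `q^L - q^m` times the summand is `q^m (U(k+1) - U(k))`. `U(L+1)`
    -- vanishes by the factor `q^L - q^L`; `U(0)` vanishes through `(1)_m` if `m > 0` and through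
    -- `q^m - 1` if `m = 0`.
    set U : ℕ → ℂ := fun k => (∏ i ∈ range k, (q ^ L - q ^ i)) / qPoch q q k
        * (qPoch q α k / qPoch q (α * q ^ (L + 1)) k)
        * (qPoch q (q ^ (-(k : ℤ))) m / qPoch q q m * qPoch q (α * q ^ k) m)
        * ((q ^ m - q ^ k) * (1 - α * q ^ (L + k))) with hU
    have hne : q ^ L - q ^ m ≠ 0 := by
      intro h
      obtain ⟨d, rfl⟩ := Nat.exists_eq_add_of_lt hlt
      have h1 : q ^ (d + 1) = 1 := by
        have := pow_ne_zero m hq0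
        rw [add_assoc, pow_add] at h
        exact mul_left_cancel₀ this (by rw [mul_one]; exact sub_eq_zero.1 h)
      have h2 : ‖q‖ ^ (d + 1) = 1 := by rw [← norm_pow, h1, norm_one]
      exact absurd h2 (pow_lt_one₀ (norm_nonneg q) hq1 (Nat.succ_ne_zero d)).ne
    have hstep : ∀ k, (q ^ L - q ^ m) * ((∏ i ∈ range k, (q ^ L - q ^ i)) / qPoch q q k
        * ((1 - α * q ^ (2 * k)) * qPoch q α k / qPoch q (α * q ^ (L + 1)) k)
        * (qPoch q (q ^ (-(k : ℤ))) m / qPoch q q m * q ^ m * qPoch q (α * q ^ k) m))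
        = q ^ m * (U (k + 1) - U k) := by
      intro k
      have a1 := qPoch_zpow_neg_succ_mul hq0 k m
      have a2 : qPoch q α (k + 1) * qPoch q (α * q ^ (k + 1)) m
          = qPoch q α k * qPoch q (α * q ^ k) m * (1 - α * q ^ (k + m)) := by
        rw [← qPoch_add, ← qPoch_add, add_right_comm, qPoch_succ]
      have a3 := qPoch_self_ne_zero hq1 (k + 1)
      have a4 := hα (k + 1)
      have a5 := qPoch_self_ne_zero hq1 m
      simp only [hU]
      rw [qPoch_succ] at a3 a4
      rw [prod_range_succ, qPoch_succ q q k, qPoch_succ q (α * q ^ (L + 1)) k]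
      have a6 := left_ne_zero_of_mul a3
      have a7 := right_ne_zero_of_mul a3
      have a8 := left_ne_zero_of_mul a4
      have a9 := right_ne_zero_of_mul a4
      have e1 : α * q ^ (L + 1) * q ^ k = α * q ^ (L + (k + 1)) := by ring
      have e2 : q * q ^ k = q ^ (k + 1) := by ring
      rw [e1] at a9 ⊢
      rw [e2] at a7 ⊢
      have e3 : (∏ i ∈ range k, (q ^ L - q ^ i)) * (q ^ L - q ^ k) /
            (qPoch q q k * (1 - q ^ (k + 1)))
          * (qPoch q α (k + 1) / (qPoch q (α * q ^ (L + 1)) k * (1 - α * q ^ (L + (k + 1)))))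
          * (qPoch q (q ^ (-((k + 1 : ℕ) : ℤ))) m / qPoch q q m * qPoch q (α * q ^ (k + 1)) m)
          * ((q ^ m - q ^ (k + 1)) * (1 - α * q ^ (L + (k + 1))))
          = (∏ i ∈ range k, (q ^ L - q ^ i)) * (q ^ L - q ^ k) / qPoch q q k
            * (qPoch q α (k + 1) * qPoch q (α * q ^ (k + 1)) m) / qPoch q (α * q ^ (L + 1)) k
            * (qPoch q (q ^ (-((k + 1 : ℕ) : ℤ))) m * (q ^ m - q ^ (k + 1))
              / (1 - q ^ (k + 1))) / qPoch q q m := by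
        field_simp
      rw [e3, a1, a2, mul_div_assoc _ (1 - q ^ (k + 1)), div_self a7]
      generalize qPoch q (q ^ (-(k : ℤ))) m = X
      field_simp
      ring
    have hsum := sum_range_sub U (L + 1)
    have hU0 : U 0 = 0 := by
      rcases Nat.eq_zero_or_pos m with h | h
      · simp [hU, h]
      · simp only [hU]
        rw [qPoch_zpow_neg_eq_zero hq0 h]; ring
    have hUL : U (L + 1) = 0 := by
      simp only [hU]
      rw [prod_range_succ, sub_self]; ring
    refine (mul_eq_zero.1 ?_).resolve_left hne
    rw [mul_sum, sum_congr rfl fun k _ => hstep k, ← mul_sum, hsum, hU0, hUL]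
    ring

/-- Bailey inversion: a sequence is recovered from its `q`-differences. -/
theorem sum_qDiff_eq (hq0 : q ≠ 0) (hq1 : ‖q‖ < 1) (α : ℂ) (φ : ℕ → ℂ) (L : ℕ)
    (hα : ∀ k, qPoch q (α * q ^ (L + 1)) k ≠ 0) :
    ∑ k ∈ range (L + 1), (∏ i ∈ range k, (q ^ L - q ^ i)) / qPoch q q k
        * ((1 - α * q ^ (2 * k)) * qPoch q α k / qPoch q (α * q ^ (L + 1)) k)
        * qDiff q k (fun m => φ m * qPoch q (α * q ^ k) m)
      = qPoch q α (L + 1) * φ L := by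
  have h1 : ∀ k ∈ range (L + 1), qDiff q k (fun m => φ m * qPoch q (α * q ^ k) m)
      = ∑ m ∈ range (L + 1), qPoch q (q ^ (-(k : ℤ))) m / qPoch q q m * q ^ m
        * (φ m * qPoch q (α * q ^ k) m) := by
    intro k hk
    rw [mem_range] at hk
    refine sum_subset (range_subset_range.2 (by omega)) fun m _ hm => ?_
    rw [qPoch_zpow_neg_eq_zero hq0 (by rw [mem_range] at hm; omega)]
    ring
  rw [sum_congr rfl fun k hk => by rw [h1 k hk, mul_sum], sum_comm]
  have h2 : ∀ m ∈ range (L + 1), ∑ k ∈ range (L + 1),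
      (∏ i ∈ range k, (q ^ L - q ^ i)) / qPoch q q k
        * ((1 - α * q ^ (2 * k)) * qPoch q α k / qPoch q (α * q ^ (L + 1)) k)
        * (qPoch q (q ^ (-(k : ℤ))) m / qPoch q q m * q ^ m * (φ m * qPoch q (α * q ^ k) m))
      = (if m = L then qPoch q α (L + 1) else 0) * φ m := by
    intro m hm
    rw [← sum_bailey_eq hq0 hq1 α (Nat.lt_succ_iff.1 (mem_range.1 hm)) hα, sum_mul]
    exact sum_congr rfl fun k _ => by ring
  rw [sum_congr rfl h2]
  simp

end Inversion

/-! ### The one-variable expansion and its analytic continuation. -/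

section Series

variable {q : ℂ}

theorem norm_prod_sub_pow_le (hq1 : ‖q‖ < 1) {z : ℂ} {R : ℝ} (hR : 0 < R) (hz : ‖z‖ ≤ R) (k : ℕ) :
    ‖∏ i ∈ range k, (z - q ^ i)‖ ≤ R ^ k * Real.exp (R⁻¹ * (1 - ‖q‖)⁻¹) := by
  calc ‖∏ i ∈ range k, (z - q ^ i)‖ ≤ ∏ i ∈ range k, (R * (1 + R⁻¹ * ‖q‖ ^ i)) := by
        rw [norm_prod]
        refine prod_le_prod (fun i _ => norm_nonneg _) fun i _ => ?_
        calc ‖z - q ^ i‖ ≤ ‖z‖ + ‖q ^ i‖ := norm_sub_le _ _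
          _ ≤ R + ‖q‖ ^ i := by rw [norm_pow]; gcongr
          _ = _ := by field_simp
    _ = R ^ k * ∏ i ∈ range k, (1 + R⁻¹ * ‖q‖ ^ i) := by
        rw [prod_mul_distrib, prod_const, card_range]
    _ ≤ _ := by
        gcongr
        exact prod_one_add_geometric_le (norm_nonneg q) hq1 (by positivity) k

/-- The `k`-th coefficient function of the expansion of `(αq, …)_∞ / (αqz, …)_∞` in the basis
`∏_{i < k} (z - q ^ i)`. -/
noncomputable def expansionTerm (q α : ℂ) (φ : ℕ → ℂ) (z : ℂ) (k : ℕ) : ℂ :=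
  (∏ i ∈ range k, (z - q ^ i)) / qPoch q q k
    * ((1 - α * q ^ (2 * k)) * qPoch q α k / ((1 - α) * qPoch q (α * q * z) k))
    * qDiff q k (fun m => φ m * qPoch q (α * q ^ k) m)

theorem expansionTerm_eq_zero (q α : ℂ) (φ : ℕ → ℂ) {L k : ℕ} (h : L < k) :
    expansionTerm q α φ (q ^ L) k = 0 := by
  rw [expansionTerm, prod_eq_zero (mem_range.2 h) (sub_self _)]
  simp

/-- This is Bailey inversion divided by `1 - α`. -/
theorem sum_expansionTerm_pow (hq0 : q ≠ 0) (hq1 : ‖q‖ < 1) {α : ℂ} (hα : 1 - α ≠ 0) (φ : ℕ → ℂ)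
    (L : ℕ) (h : qPochInf q (α * q * q ^ L) ≠ 0) :
    ∑ k ∈ range (L + 1), expansionTerm q α φ (q ^ L) k = qPoch q (α * q) L * φ L := by
  have e : α * q * q ^ L = α * q ^ (L + 1) := by ring
  rw [e] at h
  have h1 := sum_qDiff_eq hq0 hq1 α φ L (qPoch_ne_zero_of_qPochInf hq1 h)
  rw [qPoch_succ', mul_assoc, eq_comm, ← eq_inv_mul_iff_mul_eq₀ hα, mul_sum] at h1
  rw [h1]
  refine sum_congr rfl fun k _ => ?_
  have := qPoch_ne_zero_of_qPochInf hq1 h k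
  rw [expansionTerm, e]
  field_simp

/-- The terms of the expansion multiplied by `(αqz)_∞`. -/
theorem qPochInf_mul_expansionTerm (hq1 : ‖q‖ < 1) (α : ℂ) (φ : ℕ → ℂ) {z : ℂ} (k : ℕ)
    (h : qPochInf q (α * q * z) ≠ 0) :
    qPochInf q (α * q * z) * expansionTerm q α φ z k
      = (∏ i ∈ range k, (z - q ^ i)) / qPoch q q k * ((1 - α * q ^ (2 * k)) * qPoch q α k / (1 - α))
        * qPochInf q (α * q * z * q ^ k) * qDiff q k (fun m => φ m * qPoch q (α * q ^ k) m) := by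
  have h1 := qPoch_ne_zero_of_qPochInf hq1 h k
  rw [qPochInf_eq_mul hq1 _ k, expansionTerm]
  by_cases hα : 1 - α = 0
  · simp [hα]
  field_simp

theorem exists_bound_expansion (hq1 : ‖q‖ < 1) (α : ℂ) {D : ℕ → ℂ} {ρ R : ℝ}
    (hR : 0 < R) (hD : ∃ C, ∀ k, ‖D k‖ ≤ C * ρ ^ k) :
    ∃ C, ∀ (k : ℕ) (z : ℂ), ‖z‖ ≤ R →
      ‖(∏ i ∈ range k, (z - q ^ i)) / qPoch q q k * ((1 - α * q ^ (2 * k)) * qPoch q α k / (1 - α))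
        * D k‖ ≤ C * (R * ρ) ^ k := by
  obtain ⟨C, hC⟩ := hD
  obtain ⟨B, hB0, hB⟩ := exists_norm_inv_qPoch_le hq1 (qPochInf_self_ne_zero hq1)
  have hC0 : 0 ≤ C := by simpa using (norm_nonneg _).trans (hC 0)
  refine ⟨Real.exp (R⁻¹ * (1 - ‖q‖)⁻¹) * B
    * ((1 + ‖α‖) * Real.exp (‖α‖ * (1 - ‖q‖)⁻¹) / ‖1 - α‖) * C, fun k z hz => ?_⟩
  have h1 : ‖1 - α * q ^ (2 * k)‖ ≤ 1 + ‖α‖ := by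
    refine (norm_sub_le _ _).trans ?_
    rw [norm_one, norm_mul, norm_pow]
    gcongr
    exact mul_le_of_le_one_right (norm_nonneg α) (pow_le_one₀ (norm_nonneg q) hq1.le)
  rw [norm_mul, norm_mul, norm_div, norm_div, norm_mul, div_eq_mul_inv _ ‖qPoch q q k‖,
    ← norm_inv]
  calc _ ≤ R ^ k * Real.exp (R⁻¹ * (1 - ‖q‖)⁻¹) * B
        * ((1 + ‖α‖) * Real.exp (‖α‖ * (1 - ‖q‖)⁻¹) / ‖1 - α‖) * (C * ρ ^ k) := by
        gcongr
        exacts [norm_prod_sub_pow_le hq1 hR hz k, hB k, norm_qPoch_le hq1 le_rfl k, hC k]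
    _ = _ := by rw [mul_pow]; ring

/-- Nonterminating expansion, by analytic continuation from the points `z = q ^ L`. -/
theorem tsum_expansionTerm (hq0 : q ≠ 0) (hq1 : ‖q‖ < 1) {α : ℂ} (hα : 1 - α ≠ 0) {φ : ℕ → ℂ}
    {ρ R : ℝ} (hρ : 0 < ρ) (hR : 0 < R) (hRρ : R * ρ < 1)
    (hφ : ∃ C, ∀ k, ‖qDiff q k φ‖ ≤ C * ρ ^ k) {g : ℂ → ℂ}
    (hg : DifferentiableOn ℂ g (Metric.ball 0 R))
    (hgφ : ∀ L, q ^ L ∈ Metric.ball (0 : ℂ) R → g (q ^ L) = φ L)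
    {z : ℂ} (hz : z ∈ Metric.ball (0 : ℂ) R) (hαz : qPochInf q (α * q * z) ≠ 0) :
    ∑' k, expansionTerm q α φ z k = qPochInf q (α * q) / qPochInf q (α * q * z) * g z := by
  set U := Metric.ball (0 : ℂ) R
  have hU : IsOpen U := Metric.isOpen_ball
  obtain ⟨C, hC⟩ := exists_bound_expansion hq1 α hR
    (exists_norm_qDiff_mul_qPoch_pow_le hq0 hq1 α hρ hφ)
  have hC0 : 0 ≤ C := by simpa using (norm_nonneg _).trans (hC 0 0 (by simpa using hR.le))
  -- Multiplying by `(αqz)_∞` removes the poles, so each term is entire and one bound holds on the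
  -- whole disc.
  set F : ℕ → ℂ → ℂ := fun k z => (∏ i ∈ range k, (z - q ^ i)) / qPoch q q k
    * ((1 - α * q ^ (2 * k)) * qPoch q α k / (1 - α))
    * qPochInf q (α * q * z * q ^ k) * qDiff q k (fun m => φ m * qPoch q (α * q ^ k) m) with hF
  have hsummable : Summable fun k : ℕ =>
      C * (R * ρ) ^ k * Real.exp (‖α‖ * R * (1 - ‖q‖)⁻¹) :=
    ((summable_geometric_of_lt_one (by positivity) hRρ).mul_left C).mul_right _
  have hbound : ∀ (k : ℕ) (w : ℂ), w ∈ U →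
      ‖F k w‖ ≤ C * (R * ρ) ^ k * Real.exp (‖α‖ * R * (1 - ‖q‖)⁻¹) := by
    intro k w hw
    have hw' : ‖w‖ ≤ R := (mem_ball_zero_iff.1 hw).le
    have e : F k w = ((∏ i ∈ range k, (w - q ^ i)) / qPoch q q k
        * ((1 - α * q ^ (2 * k)) * qPoch q α k / (1 - α))
        * qDiff q k (fun m => φ m * qPoch q (α * q ^ k) m))
        * qPochInf q (α * q * w * q ^ k) := by simp only [hF]; ring
    rw [e, norm_mul]
    refine mul_le_mul (hC k w hw') (norm_qPochInf_le hq1 ?_) (norm_nonneg _) (by positivity)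
    have : α * q * w * q ^ k = α * w * q ^ (k + 1) := by ring
    rw [this, norm_mul, norm_mul, norm_pow]
    calc ‖α‖ * ‖w‖ * ‖q‖ ^ (k + 1) ≤ ‖α‖ * R * 1 := by
          gcongr
          exact pow_le_one₀ (norm_nonneg q) hq1.le
      _ = _ := mul_one _
  have hdiff : ∀ k, DifferentiableOn ℂ (F k) U := by
    intro k
    have h1 : Differentiable ℂ fun z : ℂ => qPochInf q (α * q * z * q ^ k) :=
      (differentiable_qPochInf hq1).comp (by fun_prop)
    simp only [hF]
    have h2 : Differentiable ℂ fun z : ℂ => ∏ i ∈ range k, (z - q ^ i) :=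
      Differentiable.fun_finsetProd fun i _ => by fun_prop
    exact (((h2.div_const _).mul_const _).mul h1 |>.mul_const _).differentiableOn
  have hA : AnalyticOnNhd ℂ (fun w => ∑' k, F k w) U :=
    (Complex.differentiableOn_tsum_of_summable_norm hsummable hdiff hU hbound).analyticOnNhd hU
  have hB : AnalyticOnNhd ℂ (fun w => qPochInf q (α * q) * g w) U :=
    (hg.const_mul _).analyticOnNhd hU
  have hpre : IsPreconnected U := (convex_ball (0 : ℂ) R).isPreconnected
  have hqL : Tendsto (fun L : ℕ => q ^ L) atTop (𝓝 0) := tendsto_pow_atTop_nhds_zero_of_norm_lt_one hq1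
  have hqL' : Tendsto (fun L : ℕ => q ^ L) atTop (𝓝[≠] 0) :=
    tendsto_nhdsWithin_iff.2 ⟨hqL, Eventually.of_forall fun L => pow_ne_zero L hq0⟩
  have hfreq : ∃ᶠ w in 𝓝[≠] (0 : ℂ), ∑' k, F k w = qPochInf q (α * q) * g w := by
    refine hqL'.frequently (Eventually.frequently ?_)
    -- The pole-free form can be compared with the original terms only where `(αq·q^L)_∞ ≠ 0`; large
    -- `L` guarantees this.
    have h1 : ∀ᶠ L : ℕ in atTop, ‖α * q * q ^ L‖ < 1 := by
      have := (hqL.const_mul (α * q)).norm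
      rw [mul_zero, norm_zero] at this
      exact this.eventually_lt_const one_pos
    filter_upwards [h1, hqL.eventually (hU.mem_nhds (Metric.mem_ball_self hR))] with L hL hLU
    have hne := qPochInf_ne_zero_of_norm_lt_one hq1 hL
    have h2 : ∀ k, F k (q ^ L) = qPochInf q (α * q * q ^ L) * expansionTerm q α φ (q ^ L) k :=
      fun k => (qPochInf_mul_expansionTerm hq1 α φ k hne).symm
    rw [tsum_congr h2, tsum_mul_left, tsum_eq_sum (s := range (L + 1)) fun k hk =>
      expansionTerm_eq_zero q α φ (by rw [mem_range] at hk; omega),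
      sum_expansionTerm_pow hq0 hq1 hα φ L hne, hgφ L hLU, qPochInf_eq_mul hq1 (α * q) L]
    ring
  have heq := hA.eqOn_of_preconnected_of_frequently_eq hB hpre (Metric.mem_ball_self hR) hfreq hz
  simp only at heq
  rw [tsum_congr fun k => (qPochInf_mul_expansionTerm hq1 α φ k hαz).symm, tsum_mul_left] at heq
  rw [div_mul_eq_mul_div, eq_div_iff hαz, ← heq, mul_comm]

/-- The coefficient sequence `(αβ, αγ)_m / (αb, αc, αd)_m`. -/
noncomputable def coeffSeq (q u v b c d : ℂ) (m : ℕ) : ℂ :=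
  (qPoch q u m * qPoch q v m) / (qPoch q b m * qPoch q c m * qPoch q d m)

/-- Start from the constant `1`, whose `q`-differences of positive order vanish, then multiply by
two factorials and divide by three. -/
theorem exists_norm_qDiff_coeffSeq_le (hq0 : q ≠ 0) (hq1 : ‖q‖ < 1) {u v b c d : ℂ} {ρ : ℝ}
    (hu : ‖u‖ < ρ) (hv : ‖v‖ < ρ) (hb : qPochInf q b ≠ 0) (hc : qPochInf q c ≠ 0)
    (hd : qPochInf q d ≠ 0) : ∃ C, ∀ k, ‖qDiff q k (coeffSeq q u v b c d)‖ ≤ C * ρ ^ k := by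
  have hρ : 0 < ρ := (norm_nonneg u).trans_lt hu
  have h1 : ∃ C, ∀ k, ‖qDiff q k fun _ => 1‖ ≤ C * ρ ^ k := by
    refine ⟨1, fun k => ?_⟩
    cases k with
    | zero => simp [qDiff_zero]
    | succ k => rw [qDiff_one hq0 hq1, norm_zero]; positivity
  have h2 := exists_norm_qDiff_div_qPoch_le hq0 hq1 hρ hd
    (exists_norm_qDiff_div_qPoch_le hq0 hq1 hρ hc (exists_norm_qDiff_div_qPoch_le hq0 hq1 hρ hb
      (exists_norm_qDiff_mul_qPoch_le hq0 hq1 hv (exists_norm_qDiff_mul_qPoch_le hq0 hq1 hu h1))))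
  have e : coeffSeq q u v b c d = fun m => 1 * qPoch q u m * qPoch q v m * (qPoch q b m)⁻¹
      * (qPoch q c m)⁻¹ * (qPoch q d m)⁻¹ := by
    funext m
    rw [coeffSeq, div_eq_mul_inv, mul_inv, mul_inv]
    ring
  rwa [e]

/-- Value of the coefficient sequence in terms of infinite products. -/
theorem coeffSeq_eq (hq1 : ‖q‖ < 1) {u v b c d : ℂ} {L : ℕ}
    (hb : qPochInf q b ≠ 0) (hc : qPochInf q c ≠ 0) (hd : qPochInf q d ≠ 0)
    (hu : qPochInf q (u * q ^ L) ≠ 0) (hv : qPochInf q (v * q ^ L) ≠ 0) :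
    coeffSeq q u v b c d L = qPochInf q u * qPochInf q v
        / (qPochInf q b * qPochInf q c * qPochInf q d)
      * (qPochInf q (b * q ^ L) * qPochInf q (c * q ^ L) * qPochInf q (d * q ^ L)
        / (qPochInf q (u * q ^ L) * qPochInf q (v * q ^ L))) := by
  rw [qPochInf_eq_mul hq1 b L] at hb ⊢
  rw [qPochInf_eq_mul hq1 c L] at hc ⊢
  rw [qPochInf_eq_mul hq1 d L] at hd ⊢
  rw [qPochInf_eq_mul hq1 u L, qPochInf_eq_mul hq1 v L, coeffSeq]
  have hb1 := left_ne_zero_of_mul hb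
  have hb2 := right_ne_zero_of_mul hb
  have hc1 := left_ne_zero_of_mul hc
  have hc2 := right_ne_zero_of_mul hc
  have hd1 := left_ne_zero_of_mul hd
  have hd2 := right_ne_zero_of_mul hd
  generalize qPochInf q (b * q ^ L) = b', qPochInf q (c * q ^ L) = c',
    qPochInf q (d * q ^ L) = d', qPochInf q (u * q ^ L) = u', qPochInf q (v * q ^ L) = v' at *
  field_simp

theorem exists_radius {z u v : ℂ} (hu : ‖u * z‖ < 1) (hv : ‖v * z‖ < 1) :
    ∃ ρ R : ℝ, 0 < ρ ∧ 0 < R ∧ R * ρ < 1 ∧ ‖z‖ < R ∧ ‖u‖ < ρ ∧ ‖v‖ < ρ := by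
  have h1 : ∀ w : ℂ, ‖w * z‖ < 1 → ∀ᶠ ε : ℝ in 𝓝[>] 0, (‖z‖ + ε) * (‖w‖ + ε) < 1 := by
    intro w hw
    have : Tendsto (fun ε : ℝ => (‖z‖ + ε) * (‖w‖ + ε)) (𝓝 0) (𝓝 ((‖z‖ + 0) * (‖w‖ + 0))) :=
      Continuous.tendsto (by fun_prop) 0
    refine (this.mono_left nhdsWithin_le_nhds).eventually_lt_const ?_
    rwa [add_zero, add_zero, mul_comm, ← norm_mul]
  obtain ⟨ε, ⟨h2, h3⟩, h4⟩ :=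
    (((h1 u hu).and (h1 v hv)).and self_mem_nhdsWithin).exists
  have h4 : 0 < ε := h4
  refine ⟨max ‖u‖ ‖v‖ + ε, ‖z‖ + ε, by positivity, by positivity, ?_, by linarith, ?_, ?_⟩
  · rcases max_choice ‖u‖ ‖v‖ with h | h <;> rwa [h]
  · linarith [le_max_left ‖u‖ ‖v‖]
  · linarith [le_max_right ‖u‖ ‖v‖]

theorem tsum_expansionTerm_coeffSeq (hq0 : q ≠ 0) (hq1 : ‖q‖ < 1) {α u v b c d z : ℂ}
    (hα : 1 - α ≠ 0) (hb : qPochInf q b ≠ 0) (hc : qPochInf q c ≠ 0) (hd : qPochInf q d ≠ 0)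
    (hu : ‖u * z‖ < 1) (hv : ‖v * z‖ < 1) (hαz : qPochInf q (α * q * z) ≠ 0) :
    ∑' k, expansionTerm q α (coeffSeq q u v b c d) z k
      = qPochInf q (α * q) / qPochInf q (α * q * z)
        * (qPochInf q u * qPochInf q v / (qPochInf q b * qPochInf q c * qPochInf q d)
          * (qPochInf q (b * z) * qPochInf q (c * z) * qPochInf q (d * z)
            / (qPochInf q (u * z) * qPochInf q (v * z)))) := by
  obtain ⟨ρ, R, hρ, hR, hRρ, hzR, huρ, hvρ⟩ := exists_radius hu hv
  -- On the disc `|wy| < Rρ < 1`, so the denominators of the closed form have no zeros there.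
  have hlt : ∀ w y : ℂ, ‖w‖ < ρ → y ∈ Metric.ball (0 : ℂ) R → qPochInf q (w * y) ≠ 0 := by
    intro w y hw hy
    rw [mem_ball_zero_iff] at hy
    refine qPochInf_ne_zero_of_norm_lt_one hq1 (lt_of_le_of_lt ?_ hRρ)
    rw [norm_mul, mul_comm]
    gcongr
  have hdiff : ∀ w : ℂ, Differentiable ℂ fun y => qPochInf q (w * y) := fun w =>
    (differentiable_qPochInf hq1).comp (by fun_prop)
  refine tsum_expansionTerm hq0 hq1 hα hρ hR hRρ
    (exists_norm_qDiff_coeffSeq_le hq0 hq1 huρ hvρ hb hc hd)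
    (g := fun y => qPochInf q u * qPochInf q v / (qPochInf q b * qPochInf q c * qPochInf q d)
      * (qPochInf q (b * y) * qPochInf q (c * y) * qPochInf q (d * y)
        / (qPochInf q (u * y) * qPochInf q (v * y)))) ?_ ?_ (mem_ball_zero_iff.2 hzR) hαz
  · refine DifferentiableOn.const_mul (DifferentiableOn.div
      (((hdiff b).mul (hdiff c)).mul (hdiff d)).differentiableOn
      ((hdiff u).mul (hdiff v)).differentiableOn fun y hy => ?_) _
    exact mul_ne_zero (hlt u y huρ hy) (hlt v y hvρ hy)
  · intro L hL
    exact (coeffSeq_eq hq1 hb hc hd (hlt u _ huρ hL) (hlt v _ hvρ hL)).symm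

theorem exists_norm_expansionTerm_le (hq0 : q ≠ 0) (hq1 : ‖q‖ < 1) {α u v b c d z : ℂ}
    (hb : qPochInf q b ≠ 0) (hc : qPochInf q c ≠ 0) (hd : qPochInf q d ≠ 0)
    (hu : ‖u * z‖ < 1) (hv : ‖v * z‖ < 1) :
    ∃ C r : ℝ, 0 ≤ r ∧ r < 1 ∧ ∀ k, ‖z ^ k * qDiff q k
      (fun m => coeffSeq q u v b c d m * qPoch q (α * q ^ k) m)‖ ≤ C * r ^ k := by
  obtain ⟨ρ, R, hρ, hR, hRρ, hzR, huρ, hvρ⟩ := exists_radius hu hv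
  obtain ⟨C, hC⟩ := exists_norm_qDiff_mul_qPoch_pow_le hq0 hq1 α hρ
    (exists_norm_qDiff_coeffSeq_le hq0 hq1 huρ hvρ hb hc hd)
  refine ⟨C, ‖z‖ * ρ, by positivity, lt_of_le_of_lt (by gcongr) hRρ, fun k => ?_⟩
  rw [norm_mul, norm_pow, mul_pow]
  calc ‖z‖ ^ k * _ ≤ ‖z‖ ^ k * (C * ρ ^ k) := by gcongr; exact hC k
    _ = _ := by ring

end Series

/-! ### Partial fractions by Lagrange interpolation. -/

section Milne

variable {q : ℂ}

/-- Lagrange interpolation at the nodes `y i`, evaluated at `0`. -/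
theorem sum_prod_one_sub_div {ι : Type*} [Fintype ι] [DecidableEq ι] {y c : ι → ℂ}
    (hy : ∀ i, y i ≠ 0) (hinj : Function.Injective y) :
    ∑ i, (∏ s, (1 - c s * y i / y s)) / ∏ j ∈ univ.erase i, (1 - y i / y j) = 1 - ∏ s, c s := by
  -- The subtracted product vanishes at every node and cancels the top coefficient, so interpolation
  -- at the nodes recovers the polynomial exactly.
  set Q : Polynomial ℂ := (∏ s, (1 - Polynomial.C (c s / y s) * Polynomial.X))
    - Polynomial.C (∏ s, c s) * ∏ s, (1 - Polynomial.C (1 / y s) * Polynomial.X) with hQ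
  have hdeg : ∀ g : ι → ℂ,
      (∏ s, (1 - Polynomial.C (g s) * (Polynomial.X : Polynomial ℂ))).natDegree ≤ Fintype.card ι
      ∧ (∏ s, (1 - Polynomial.C (g s) * (Polynomial.X : Polynomial ℂ))).coeff (Fintype.card ι)
        = ∏ s, (-g s) := by
    intro g
    have h1 : ∀ s, (1 - Polynomial.C (g s) * (Polynomial.X : Polynomial ℂ)).natDegree ≤ 1 := by
      intro s; compute_degree
    refine ⟨?_, ?_⟩
    · refine (Polynomial.natDegree_prod_le _ _).trans ?_
      calc _ ≤ ∑ _s : ι, 1 := sum_le_sum fun s _ => h1 s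
        _ = _ := by simp
    · have h2 := Polynomial.coeff_prod_of_natDegree_le univ
        (fun s => 1 - Polynomial.C (g s) * (Polynomial.X : Polynomial ℂ)) 1 fun s _ => h1 s
      rw [card_univ, mul_one] at h2
      rw [h2]
      refine prod_congr rfl fun s _ => ?_
      simp [Polynomial.coeff_one]
  have hQdeg : Q.degree < #(univ : Finset ι) := by
    rw [card_univ, Polynomial.degree_lt_iff_coeff_zero]
    intro m hm
    obtain ⟨h1, h2⟩ := hdeg fun s => c s / y s
    obtain ⟨h3, h4⟩ := hdeg fun s => 1 / y s
    rw [hQ, Polynomial.coeff_sub, Polynomial.coeff_C_mul]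
    rcases hm.lt_or_eq with h | rfl
    · rw [Polynomial.coeff_eq_zero_of_natDegree_lt (h1.trans_lt h),
        Polynomial.coeff_eq_zero_of_natDegree_lt (h3.trans_lt h)]
      simp
    · rw [h2, h4, ← prod_mul_distrib, sub_eq_zero]
      exact prod_congr rfl fun s _ => by ring
  have h0 := congrArg (Polynomial.eval 0) (Lagrange.eq_interpolate hinj.injOn hQdeg)
  rw [Lagrange.interpolate_apply, Polynomial.eval_finsetSum] at h0
  have hQ0 : Q.eval 0 = 1 - ∏ s, c s := by
    simp [hQ, Polynomial.eval_prod]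
  rw [hQ0] at h0
  rw [h0]
  refine sum_congr rfl fun i _ => ?_
  have hQi : Q.eval (y i) = ∏ s, (1 - c s * y i / y s) := by
    have : ∏ s, (1 - 1 / y s * y i) = 0 :=
      prod_eq_zero (mem_univ i) (by rw [one_div, inv_mul_cancel₀ (hy i), sub_self])
    rw [hQ, Polynomial.eval_sub, Polynomial.eval_mul, Polynomial.eval_prod, Polynomial.eval_prod]
    simp only [Polynomial.eval_sub, Polynomial.eval_one, Polynomial.eval_mul, Polynomial.eval_C,
      Polynomial.eval_X]
    rw [this, mul_zero, sub_zero]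
    exact prod_congr rfl fun s _ => by ring
  rw [Polynomial.eval_mul, Polynomial.eval_C, hQi, Lagrange.basis, Polynomial.eval_prod,
    div_eq_mul_inv, ← prod_inv_distrib]
  congr 1
  refine prod_congr rfl fun j hj => ?_
  have hij : y i - y j ≠ 0 := sub_ne_zero.2 fun h => (ne_of_mem_erase hj) (hinj h).symm
  have hji : y j - y i ≠ 0 := sub_ne_zero.2 fun h => (ne_of_mem_erase hj) (hinj h)
  have := hy j
  simp only [Lagrange.basisDivisor, Polynomial.eval_mul, Polynomial.eval_C, Polynomial.eval_sub,
    Polynomial.eval_X]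
  have h1 : 1 - y i / y j ≠ 0 := by
    rw [one_sub_div this]; exact div_ne_zero hji this
  field_simp
  ring

end Milne

/-! ### Milne's fundamental theorem for `A_n` series. -/

section Milne

variable {q : ℂ} {n : ℕ}

theorem prod_prod_Ioi_eq (F : Fin n → Fin n → ℂ) (i : Fin n) :
    ∏ r, ∏ s ∈ Ioi r, F r s
      = (∏ j ∈ univ.erase i, if i < j then F i j else F j i)
        * ∏ r ∈ univ.erase i, ∏ s ∈ (Ioi r).erase i, F r s := by
  have h1 : ∀ r ∈ univ.erase i, ∏ s ∈ Ioi r, F r s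
      = (if r < i then F r i else 1) * ∏ s ∈ (Ioi r).erase i, F r s := by
    intro r _
    split_ifs with h
    · exact (mul_prod_erase _ _ (mem_Ioi.2 h)).symm
    · rw [erase_eq_of_notMem (by simpa using h), one_mul]
  have h2 : ∏ s ∈ Ioi i, F i s = ∏ j ∈ univ.erase i, if i < j then F i j else 1 := by
    rw [← prod_filter]
    refine prod_congr ?_ fun _ _ => rfl
    ext j
    simp only [mem_Ioi, mem_filter, mem_erase, mem_univ, and_true]
    exact ⟨fun h => ⟨h.ne', h⟩, fun h => h.2⟩
  rw [← mul_prod_erase univ _ (mem_univ i), prod_congr rfl h1, prod_mul_distrib, h2, ← mul_assoc,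
    ← prod_mul_distrib]
  congr 1
  refine prod_congr rfl fun j hj => ?_
  rcases lt_or_gt_of_ne (ne_of_mem_erase hj) with h | h
  · simp [h, h.not_gt]
  · simp [h, h.not_gt]

/-- The quotient of a Vandermonde product by the factors `1 - y i / y j` does not depend
on `y i`. -/
theorem vandermonde_div_congr {y y' : Fin n → ℂ} (w : Fin n → Fin n → ℂ) (i : Fin n)
    (h : ∀ j, j ≠ i → y' j = y j) (hy0 : ∀ j, y j ≠ 0)
    (hy : ∀ j, j ≠ i → y j ≠ y i) (hy' : ∀ j, j ≠ i → y j ≠ y' i) :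
    (∏ r, ∏ s ∈ Ioi r, (y s - y r) / w r s) / ∏ j ∈ univ.erase i, (1 - y i / y j)
      = (∏ r, ∏ s ∈ Ioi r, (y' s - y' r) / w r s)
        / ∏ j ∈ univ.erase i, (1 - y' i / y' j) := by
  rw [prod_prod_Ioi_eq _ i, prod_prod_Ioi_eq (fun r s => (y' s - y' r) / w r s) i,
    mul_div_right_comm, mul_div_right_comm, ← prod_div_distrib, ← prod_div_distrib]
  congr 1
  · refine prod_congr rfl fun j hj => ?_
    have hj := ne_of_mem_erase hj
    rw [h j hj]
    have h0 := hy0 j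
    have h1 := sub_ne_zero.2 (hy j hj)
    have h2 := sub_ne_zero.2 (hy' j hj)
    rw [one_sub_div h0, one_sub_div h0]
    split_ifs
    · rw [div_div_eq_mul_div, div_div_eq_mul_div, div_eq_div_iff h1 h2]; ring
    · rw [div_div_eq_mul_div, div_div_eq_mul_div, div_eq_div_iff h1 h2]; ring
  · refine prod_congr rfl fun r hr => prod_congr rfl fun s hs => ?_
    rw [h r (ne_of_mem_erase hr), h s (ne_of_mem_erase hs)]

/-- The summand of Milne's fundamental theorem of `A_n` series. -/
noncomputable def milneTerm (q : ℂ) (x c : Fin n → ℂ) (m : Fin n → ℕ) : ℂ :=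
  anFactor q x m
    * (∏ r, ∏ s, qPoch q (c s * x r / x s) (m r) / qPoch q (q * x r / x s) (m r))
    * q ^ (∑ r : Fin n, (r : ℕ) * m r)

theorem pow_sum_mul_eq_prod (q : ℂ) (m : Fin n → ℕ) :
    q ^ (∑ r : Fin n, (r : ℕ) * m r) = ∏ r, ∏ s ∈ Ioi r, q ^ m s := by
  rw [prod_comm' (t' := univ) (s' := fun s => Iio s) (by simp), ← prod_pow_eq_pow_sum]
  refine prod_congr rfl fun s _ => ?_
  rw [prod_const, Fin.card_Iio, ← pow_mul, mul_comm]

theorem anFactor_mul_pow (hq0 : q ≠ 0) (x : Fin n → ℂ) (m : Fin n → ℕ) :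
    anFactor q x m * q ^ (∑ r : Fin n, (r : ℕ) * m r)
      = ∏ r, ∏ s ∈ Ioi r, (q ^ m s - q ^ m r * x r / x s) / (1 - x r / x s) := by
  rw [pow_sum_mul_eq_prod, anFactor, ← prod_mul_distrib]
  refine prod_congr rfl fun r _ => ?_
  rw [← prod_mul_distrib]
  refine prod_congr rfl fun s _ => ?_
  have := pow_ne_zero (m s) hq0
  rw [zpow_sub₀ hq0, zpow_natCast, zpow_natCast, div_mul_eq_mul_div]
  congr 1
  field_simp

theorem anFactor_mul_pow_eq_vandermonde (hq0 : q ≠ 0) {x : Fin n → ℂ} (hx : ∀ r, x r ≠ 0)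
    (m : Fin n → ℕ) :
    anFactor q x m * q ^ (∑ r : Fin n, (r : ℕ) * m r)
      = ∏ r, ∏ s ∈ Ioi r, (x s * q ^ m s - x r * q ^ m r) / (x s - x r) := by
  rw [anFactor_mul_pow hq0]
  refine prod_congr rfl fun r _ => prod_congr rfl fun s _ => ?_
  have := hx s
  rw [one_sub_div this, div_div_eq_mul_div]
  congr 1
  field_simp

/-- A coincidence of nodes reads `x_r = x_s q^d`; `d = 0` kills `1 - x_r/x_s` (or its inverse
version) and `d > 0` kills `(q x_s/x_r)_d`. -/
theorem injective_mul_pow (hq0 : q ≠ 0) {x : Fin n → ℂ} (hx : ∀ r, x r ≠ 0)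
    (hxx : ∀ r s, r < s → 1 - x r / x s ≠ 0)
    (hxq : ∀ (r s : Fin n) (k : ℕ), qPoch q (q * x r / x s) k ≠ 0) (m : Fin n → ℕ) :
    Function.Injective fun r => x r * q ^ m r := by
  have hne : ∀ r s, r ≠ s → x r ≠ x s := by
    intro r s hrs h
    rcases lt_or_gt_of_ne hrs with h' | h'
    · exact hxx r s h' (by rw [h, div_self (hx s), sub_self])
    · exact hxx s r h' (by rw [h, div_self (hx s), sub_self])
  have key : ∀ r s, r ≠ s → m r ≤ m s → x r * q ^ m r ≠ x s * q ^ m s := by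
    intro r s hrs hm h
    obtain ⟨d, hd⟩ := Nat.exists_eq_add_of_le hm
    have h1 : x r = x s * q ^ d := by
      have := pow_ne_zero (m r) hq0
      rw [hd, pow_add] at h
      exact mul_right_cancel₀ this (by rw [h]; ring)
    cases d with
    | zero => exact hne r s hrs (by simpa using h1)
    | succ d =>
      refine hxq s r (d + 1) ?_
      rw [qPoch_succ]
      refine mul_eq_zero_of_right _ ?_
      have h2 : q * x s / x r * q ^ d = 1 := by
        rw [div_mul_eq_mul_div, div_eq_one_iff_eq (hx r), h1]; ring
      rw [h2, sub_self]
  intro r s h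
  by_contra hrs
  rcases le_total (m r) (m s) with hm | hm
  · exact key r s hrs hm h
  · exact key s r (Ne.symm hrs) hm h.symm

theorem milneTerm_eq (hq0 : q ≠ 0) {x : Fin n → ℂ} (hx : ∀ r, x r ≠ 0) (c : Fin n → ℂ)
    (m : Fin n → ℕ) :
    milneTerm q x c m
      = (∏ r, ∏ s ∈ Ioi r, (x s * q ^ m s - x r * q ^ m r) / (x s - x r))
        * ∏ r, ∏ s, qPoch q (c s * x r / x s) (m r) / qPoch q (q * x r / x s) (m r) := by
  rw [← anFactor_mul_pow_eq_vandermonde hq0 hx, milneTerm]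
  ring

/-- Raising `m_i` changes only row `i` of the factorials, and the Vandermonde quotient does not see
`y_i`. Hence the interpolation weight built from `c` at `m` matches the one built from the
denominators at `m + e_i`. -/
theorem milneTerm_step (hq0 : q ≠ 0) {x : Fin n → ℂ} (hx : ∀ r, x r ≠ 0)
    (hxx : ∀ r s, r < s → 1 - x r / x s ≠ 0)
    (hxq : ∀ (r s : Fin n) (k : ℕ), qPoch q (q * x r / x s) k ≠ 0) (c : Fin n → ℂ)
    (m : Fin n → ℕ) (i : Fin n) :
    milneTerm q x c m * ((∏ s, (1 - c s * (x i * q ^ m i) / x s))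
        / ∏ j ∈ univ.erase i, (1 - x i * q ^ m i / (x j * q ^ m j)))
      = milneTerm q x c (m + Pi.single i 1)
        * ((∏ s, (1 - x i * q ^ (m + Pi.single i 1 : Fin n → ℕ) i / x s))
          / ∏ j ∈ univ.erase i, (1 - x i * q ^ (m + Pi.single i 1 : Fin n → ℕ) i
            / (x j * q ^ (m + Pi.single i 1 : Fin n → ℕ) j))) := by
  set m' : Fin n → ℕ := m + Pi.single i 1 with hm'
  have hi : m' i = m i + 1 := by simp [hm']
  have hj : ∀ j, j ≠ i → m' j = m j := fun j hj => by simp [hm', hj]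
  have hinj := injective_mul_pow hq0 hx hxx hxq m
  have hinj' := injective_mul_pow hq0 hx hxx hxq m'
  have hV := vandermonde_div_congr (y := fun r => x r * q ^ m r) (y' := fun r => x r * q ^ m' r)
    (fun r s => x s - x r) i (fun j h => by simp only [hj j h])
    (fun j => mul_ne_zero (hx j) (pow_ne_zero _ hq0)) (fun j h => hinj.ne h)
    (fun j h => by
      have := hinj'.ne h
      simp only [hj j h] at this
      exact this)
  have hP : (∏ r, ∏ s, qPoch q (c s * x r / x s) (m' r) / qPoch q (q * x r / x s) (m' r))
      * ∏ s, (1 - x i * q ^ m' i / x s)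
      = (∏ r, ∏ s, qPoch q (c s * x r / x s) (m r) / qPoch q (q * x r / x s) (m r))
        * ∏ s, (1 - c s * (x i * q ^ m i) / x s) := by
    rw [← mul_prod_erase univ _ (mem_univ i), ← mul_prod_erase univ
      (fun r => ∏ s, qPoch q (c s * x r / x s) (m r) / qPoch q (q * x r / x s) (m r))
      (mem_univ i), mul_right_comm, mul_right_comm _ _ (∏ s, (1 - c s * (x i * q ^ m i) / x s)),
      ← prod_mul_distrib, ← prod_mul_distrib]
    congr 1
    · refine prod_congr rfl fun s _ => ?_
      have h1 := hxq i s (m i + 1)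
      rw [hi]
      rw [qPoch_succ] at h1
      rw [qPoch_succ, qPoch_succ]
      have h2 := left_ne_zero_of_mul h1
      have h3 := right_ne_zero_of_mul h1
      have e1 : 1 - x i * q ^ (m i + 1) / x s = 1 - q * x i / x s * q ^ m i := by ring
      have e2 : c s * (x i * q ^ m i) / x s = c s * x i / x s * q ^ m i := by ring
      rw [e1, e2]
      generalize 1 - q * x i / x s * q ^ m i = w at *
      field_simp
    · refine prod_congr rfl fun r hr => prod_congr rfl fun s _ => ?_
      rw [hj r (ne_of_mem_erase hr)]
  rw [milneTerm_eq hq0 hx, milneTerm_eq hq0 hx]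
  have e : ∀ V P S D V' P' S' D' : ℂ, V / D = V' / D' → P' * S' = P * S →
      V * P * (S / D) = V' * P' * (S' / D') := by
    intro V P S D V' P' S' D' h1 h2
    calc V * P * (S / D) = V / D * (P * S) := by ring
      _ = V' / D' * (P' * S') := by rw [h1, h2]
      _ = _ := by ring
  exact e _ _ _ _ _ _ _ _ hV hP

/-- Milne's fundamental theorem of `A_n` basic hypergeometric series. -/
theorem sum_milneTerm (hq0 : q ≠ 0) (hq1 : ‖q‖ < 1) {x : Fin n → ℂ} (hx : ∀ r, x r ≠ 0)
    (hxx : ∀ r s, r < s → 1 - x r / x s ≠ 0)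
    (hxq : ∀ (r s : Fin n) (k : ℕ), qPoch q (q * x r / x s) k ≠ 0) (c : Fin n → ℂ) (M : ℕ) :
    ∑ m ∈ piAntidiag univ M, milneTerm q x c m = qPoch q (∏ s, c s) M / qPoch q q M := by
  induction M with
  | zero =>
    have h : anFactor q x 0 = 1 := prod_eq_one fun r _ => prod_eq_one fun s hs => by
      simpa using div_self (hxx r s (mem_Ioi.1 hs))
    simp [milneTerm, h, qPoch_zero]
  | succ M IH =>
    have hpow : ∀ m : Fin n → ℕ, ∏ s, q ^ m s = q ^ (∑ s, m s) := fun m =>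
      prod_pow_eq_pow_sum _ _ _
    -- Interpolation at the nodes `x_r q^{m_r}` with parameters `c_s q^{m_s}`; `hB` uses the
    -- parameters `q^{m_s}`.
    have hA : ∀ m ∈ piAntidiag (univ : Finset (Fin n)) M,
        milneTerm q x c m * (1 - (∏ s, c s) * q ^ M) = ∑ i, milneTerm q x c m
          * ((∏ s, (1 - c s * (x i * q ^ m i) / x s))
            / ∏ j ∈ univ.erase i, (1 - x i * q ^ m i / (x j * q ^ m j))) := by
      intro m hm
      have hm := (mem_piAntidiag.1 hm).1
      rw [← mul_sum, ← hm, ← hpow, ← prod_mul_distrib,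
        ← sum_prod_one_sub_div (y := fun r => x r * q ^ m r)
          (fun r => mul_ne_zero (hx r) (pow_ne_zero _ hq0)) (injective_mul_pow hq0 hx hxx hxq m)]
      congr 1
      refine sum_congr rfl fun i _ => ?_
      congr 1
      refine prod_congr rfl fun s _ => ?_
      have := pow_ne_zero (m s) hq0
      have := hx s
      field_simp
    have hB : ∀ m ∈ piAntidiag (univ : Finset (Fin n)) (M + 1),
        milneTerm q x c m * (1 - q ^ (M + 1)) = ∑ i, milneTerm q x c m
          * ((∏ s, (1 - x i * q ^ m i / x s))
            / ∏ j ∈ univ.erase i, (1 - x i * q ^ m i / (x j * q ^ m j))) := by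
      intro m hm
      have hm := (mem_piAntidiag.1 hm).1
      rw [← mul_sum, ← hm, ← hpow,
        ← sum_prod_one_sub_div (y := fun r => x r * q ^ m r)
          (fun r => mul_ne_zero (hx r) (pow_ne_zero _ hq0)) (injective_mul_pow hq0 hx hxx hxq m)]
      congr 1
      refine sum_congr rfl fun i _ => ?_
      congr 1
      refine prod_congr rfl fun s _ => ?_
      have := pow_ne_zero (m s) hq0
      have := hx s
      field_simp
    have hrec : (∑ m ∈ piAntidiag univ M, milneTerm q x c m) * (1 - (∏ s, c s) * q ^ M)
        = (∑ m ∈ piAntidiag univ (M + 1), milneTerm q x c m) * (1 - q ^ (M + 1)) := by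
      rw [sum_mul, sum_mul, sum_congr rfl hA, sum_congr rfl hB, sum_comm,
        sum_comm (s := piAntidiag univ (M + 1))]
      refine sum_congr rfl fun i _ => sum_of_injOn (fun m => m + Pi.single i 1)
        (fun m _ m' _ h => add_right_cancel h) ?_ ?_ ?_
      · intro m hm
        rw [mem_coe, mem_piAntidiag] at hm ⊢
        refine ⟨?_, fun _ _ => mem_univ _⟩
        simp only [Pi.add_apply, sum_add_distrib, hm.1]
        simp
      -- Points missed by the shift have `m_i = 0`, where the factor `s = i` vanishes.
      · intro m hm hnot
        have hmi : m i = 0 := by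
          by_contra h
          refine hnot ⟨m - Pi.single i 1, ?_, ?_⟩
          · rw [mem_coe, mem_piAntidiag]
            refine ⟨?_, fun _ _ => mem_univ _⟩
            have h1 := (mem_piAntidiag.1 hm).1
            have h2 : m = (m - Pi.single i 1) + Pi.single i 1 := by
              funext j
              rcases eq_or_ne j i with rfl | hj
              · simp; omega
              · simp [hj]
            rw [h2] at h1
            simp only [Pi.add_apply, sum_add_distrib] at h1
            simpa using h1
          · funext j
            rcases eq_or_ne j i with rfl | hj
            · simp; omega
            · simp [hj]
        have h0 : ∏ s, (1 - x i * q ^ m i / x s) = 0 :=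
          prod_eq_zero (mem_univ i) (by rw [hmi, pow_zero, mul_one, div_self (hx i), sub_self])
        rw [h0]; ring
      · exact fun m _ => milneTerm_step hq0 hx hxx hxq c m i
    have hne := qPoch_self_ne_zero hq1 (M + 1)
    rw [qPoch_succ, ← pow_succ'] at hne
    have h1 := left_ne_zero_of_mul hne
    have h2 := right_ne_zero_of_mul hne
    rw [IH] at hrec
    rw [qPoch_succ, qPoch_succ, ← pow_succ', eq_div_iff hne]
    rw [div_mul_eq_mul_div, div_eq_iff h1] at hrec
    rw [hrec]; ring

/-- The power `q^{∑ (r-1) m_r}` supplies `q^{m_s}` to each pair `r < s`, clearing the negative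
powers of `q`. -/
theorem exists_norm_milneTerm_le (hq0 : q ≠ 0) (hq1 : ‖q‖ < 1) (x c : Fin n → ℂ)
    (hxq : ∀ (r s : Fin n) (k : ℕ), qPoch q (q * x r / x s) k ≠ 0) :
    ∃ C, 0 < C ∧ ∀ m, ‖milneTerm q x c m‖ ≤ C := by
  choose B hB0 hB using fun r s : Fin n =>
    exists_norm_inv_qPoch_le hq1 (qPochInf_ne_zero_of_qPoch hq1 (hxq r s))
  set C := (∏ r : Fin n, ∏ s ∈ Ioi r, (1 + ‖x r / x s‖) / ‖1 - x r / x s‖)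
    * ∏ r, ∏ s, (Real.exp (‖c s * x r / x s‖ * (1 - ‖q‖)⁻¹) * B r s) with hC
  have hbound : ∀ m, ‖milneTerm q x c m‖ ≤ C := by
    intro m
    have e : milneTerm q x c m
        = (∏ r, ∏ s ∈ Ioi r, (q ^ m s - q ^ m r * x r / x s) / (1 - x r / x s))
          * ∏ r, ∏ s, qPoch q (c s * x r / x s) (m r) / qPoch q (q * x r / x s) (m r) := by
      rw [← anFactor_mul_pow hq0, milneTerm]; ring
    have hpow : ∀ k : ℕ, ‖q ^ k‖ ≤ 1 := fun k => by
      rw [norm_pow]; exact pow_le_one₀ (norm_nonneg q) hq1.le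
    rw [e, norm_mul, hC]
    refine mul_le_mul ?_ ?_ (norm_nonneg _) (by positivity)
    · simp only [norm_prod]
      refine prod_le_prod (fun r _ => by positivity) fun r _ =>
        prod_le_prod (fun s _ => by positivity) fun s _ => ?_
      rw [norm_div]
      gcongr
      refine (norm_sub_le _ _).trans (add_le_add (hpow _) ?_)
      rw [mul_div_assoc, norm_mul]
      exact mul_le_of_le_one_left (norm_nonneg _) (hpow _)
    · simp only [norm_prod]
      refine prod_le_prod (fun r _ => by positivity) fun r _ =>
        prod_le_prod (fun s _ => by positivity) fun s _ => ?_
      rw [div_eq_mul_inv, norm_mul]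
      gcongr
      exacts [norm_qPoch_le hq1 le_rfl _, hB r s _]
  exact ⟨C + 1, by linarith [(norm_nonneg _).trans (hbound 0)],
    fun m => (hbound m).trans (by linarith)⟩

theorem milneTerm_eq_zero {x c : Fin n → ℂ} {m : Fin n → ℕ} (r : Fin n) (hxr : x r ≠ 0)
    (h : qPoch q (c r) (m r) = 0) : milneTerm q x c m = 0 := by
  have : ∏ r, ∏ s, qPoch q (c s * x r / x s) (m r) / qPoch q (q * x r / x s) (m r) = 0 :=
    prod_eq_zero (mem_univ r) (prod_eq_zero (mem_univ r) (by
      rw [mul_div_cancel_right₀ _ hxr, h, zero_div]))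
  rw [milneTerm, this]; ring

end Milne

/-! ### Collapse of the multiple sums and the final identity. -/

section Main

variable {q : ℂ} {n : ℕ}

theorem pow_sum_succ_mul (q : ℂ) (m : Fin n → ℕ) :
    q ^ (∑ r : Fin n, ((r : ℕ) + 1) * m r) = q ^ (∑ r : Fin n, (r : ℕ) * m r) * q ^ wt m := by
  rw [← pow_add, wt, ← sum_add_distrib]
  congr 1
  exact sum_congr rfl fun r _ => by ring

/-- By Milne's theorem, the inner sum is a one-dimensional `q`-difference. -/
theorem innerSum_eq_qDiff (hq0 : q ≠ 0) (hq1 : ‖q‖ < 1) (α b c d β γ : ℂ) {x : Fin n → ℂ}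
    (hx : ∀ r, x r ≠ 0) (hxx : ∀ r s, r < s → 1 - x r / x s ≠ 0)
    (hxq : ∀ (r s : Fin n) (k : ℕ), qPoch q (q * x r / x s) k ≠ 0) (k : Fin n → ℕ) :
    innerSum q α b c d β γ x k = qDiff q (wt k) fun m =>
      coeffSeq q (α * β) (α * γ) (α * b) (α * c) (α * d) m * qPoch q (α * q ^ wt k) m := by
  set g : ℕ → ℂ := fun M => coeffSeq q (α * β) (α * γ) (α * b) (α * c) (α * d) M
    * qPoch q (α * q ^ wt k) M with hg
  set C : Fin n → ℂ := fun s => q ^ (-(k s : ℤ)) with hC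
  have hCprod : ∏ s, C s = q ^ (-(wt k : ℤ)) := by
    simp only [hC, zpow_neg, zpow_natCast, wt, prod_inv_distrib]
    rw [prod_pow_eq_pow_sum]
  have h1 : innerSum q α b c d β γ x k
      = ∑ m ∈ Fintype.piFinset fun r => range (k r + 1),
          milneTerm q x C m * (q ^ wt m * g (wt m)) := by
    rw [innerSum]
    refine sum_congr rfl fun m _ => ?_
    rw [pow_sum_succ_mul, milneTerm]
    simp only [hg, coeffSeq]
    ring
  have hmaps : ∀ m ∈ Fintype.piFinset fun r => range (k r + 1), wt m ∈ range (wt k + 1) := by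
    intro m hm
    rw [Fintype.mem_piFinset] at hm
    rw [mem_range, Nat.lt_succ_iff]
    exact sum_le_sum fun r _ => Nat.lt_succ_iff.1 (mem_range.1 (hm r))
  rw [h1, ← sum_fiberwise_of_maps_to hmaps, qDiff]
  refine sum_congr rfl fun M _ => ?_
  have h2 : ∑ m ∈ (Fintype.piFinset fun r => range (k r + 1)) with wt m = M,
      milneTerm q x C m * (q ^ wt m * g (wt m))
      = ∑ m ∈ piAntidiag univ M, milneTerm q x C m * (q ^ M * g M) := by
    -- The box constraint may be dropped: `(q^{-k_r})_{m_r} = 0` once `m_r > k_r`.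
    refine sum_subset_zero_on_sdiff ?_ ?_ ?_
    · intro m hm
      rw [mem_filter] at hm
      exact mem_piAntidiag.2 ⟨hm.2, fun _ _ => mem_univ _⟩
    · intro m hm
      rw [Finset.mem_sdiff, mem_filter, Fintype.mem_piFinset, not_and, mem_piAntidiag] at hm
      have : ¬ ∀ r, m r ∈ range (k r + 1) := fun h => hm.2 h hm.1.1
      push Not at this
      obtain ⟨r, hr⟩ := this
      rw [mem_range, not_lt] at hr
      have h0 : qPoch q (C r) (m r) = 0 := qPoch_zpow_neg_eq_zero hq0 (by omega)
      rw [milneTerm_eq_zero (x := x) (c := C) (m := m) r (hx r) h0, zero_mul]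
    · intro m hm
      rw [(mem_filter.1 hm).2]
  rw [h2, ← sum_mul, sum_milneTerm hq0 hq1 hx hxx hxq, hCprod]
  ring

theorem outerTerm_eq (hq0 : q ≠ 0) (hq1 : ‖q‖ < 1) (α b c d β γ : ℂ) {a x : Fin n → ℂ}
    (hx : ∀ r, x r ≠ 0) (hxx : ∀ r s, r < s → 1 - x r / x s ≠ 0)
    (hxq : ∀ (r s : Fin n) (k : ℕ), qPoch q (q * x r / x s) k ≠ 0) (k : Fin n → ℕ) :
    outerTerm q α b c d β γ a x k
      = milneTerm q x (fun s => q / a s) k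
        * (((1 - α * q ^ (2 * wt k)) * qPoch q α (wt k)
            / ((1 - α) * qPoch q (α * q * ((∏ r, a r) / q ^ n)) (wt k)))
          * (((∏ r, a r) / q ^ n) ^ wt k * qDiff q (wt k) fun m =>
            coeffSeq q (α * β) (α * γ) (α * b) (α * c) (α * d) m * qPoch q (α * q ^ wt k) m)) := by
  have e1 : α * (∏ r, a r) * q ^ (1 - (n : ℤ)) = α * q * ((∏ r, a r) / q ^ n) := by
    rw [zpow_sub₀ hq0, zpow_one, zpow_natCast]; ring
  have e2 : q ^ (((∑ r : Fin n, (r : ℕ) * k r : ℕ) : ℤ) - (n : ℤ) * (wt k : ℤ))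
      = q ^ (∑ r : Fin n, (r : ℕ) * k r) / (q ^ n) ^ wt k := by
    rw [zpow_sub₀ hq0, zpow_natCast, zpow_mul, zpow_natCast, zpow_natCast]
  have e3 : ∀ r s, q * x r / (x s * a s) = q / a s * x r / x s := fun r s => by
    rw [div_mul_eq_mul_div, div_div, mul_comm (a s)]
  rw [outerTerm, innerSum_eq_qDiff hq0 hq1 α b c d β γ hx hxx hxq, e1, e2, milneTerm, div_pow]
  simp only [e3]
  ring

/-- Milne's theorem with `c_s = q/a_s` gives `(1/z)_K / (q)_K`, and `z^K (1/z)_K = ∏_{i<K} (z -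
q^i)`. -/
theorem sum_outerTerm_eq_expansionTerm (hq0 : q ≠ 0) (hq1 : ‖q‖ < 1) (α b c d β γ : ℂ)
    {a x : Fin n → ℂ} (ha : ∀ r, a r ≠ 0)
    (hx : ∀ r, x r ≠ 0) (hxx : ∀ r s, r < s → 1 - x r / x s ≠ 0)
    (hxq : ∀ (r s : Fin n) (k : ℕ), qPoch q (q * x r / x s) k ≠ 0) (K : ℕ) :
    ∑ k ∈ piAntidiag univ K, outerTerm q α b c d β γ a x k
      = expansionTerm q α (coeffSeq q (α * β) (α * γ) (α * b) (α * c) (α * d))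
        ((∏ r, a r) / q ^ n) K := by
  set z := (∏ r, a r) / q ^ n with hz
  have hz0 : z ≠ 0 := div_ne_zero (prod_ne_zero_iff.2 fun r _ => ha r) (pow_ne_zero _ hq0)
  have h1 : ∀ k ∈ piAntidiag (univ : Finset (Fin n)) K, outerTerm q α b c d β γ a x k
      = milneTerm q x (fun s => q / a s) k
        * (((1 - α * q ^ (2 * K)) * qPoch q α K / ((1 - α) * qPoch q (α * q * z) K))
          * (z ^ K * qDiff q K fun m => coeffSeq q (α * β) (α * γ) (α * b) (α * c) (α * d) m
            * qPoch q (α * q ^ K) m)) := by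
    intro k hk
    have hk : wt k = K := (mem_piAntidiag.1 hk).1
    rw [outerTerm_eq hq0 hq1 α b c d β γ hx hxx hxq, hk]
  have h2 : ∏ s, q / a s = z⁻¹ := by
    rw [prod_div_distrib, prod_const, card_univ, Fintype.card_fin, hz, inv_div]
  have h3 : qPoch q z⁻¹ K * z ^ K = ∏ i ∈ range K, (z - q ^ i) := by
    rw [qPoch, ← card_range K, ← prod_const, card_range, ← prod_mul_distrib]
    exact prod_congr rfl fun i _ => by field_simp
  rw [sum_congr rfl h1, ← sum_mul, sum_milneTerm hq0 hq1 hx hxx hxq, h2, expansionTerm, ← h3]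
  ring

theorem summable_pow_wt {r : ℝ} (hr0 : 0 ≤ r) (hr1 : r < 1) :
    Summable fun k : Fin n → ℕ => r ^ wt k := by
  refine summable_of_sum_le (c := ∏ _i : Fin n, (1 - r)⁻¹) (fun k => by positivity) fun u => ?_
  set N := u.sup wt with hN
  have hsub : u ⊆ Fintype.piFinset fun _ : Fin n => range (N + 1) := by
    intro k hk
    rw [Fintype.mem_piFinset]
    intro i
    rw [mem_range, Nat.lt_succ_iff]
    exact (single_le_sum (fun _ _ => Nat.zero_le _) (mem_univ i)).trans (le_sup (f := wt) hk)
  calc ∑ k ∈ u, r ^ wt k ≤ ∑ k ∈ Fintype.piFinset fun _ : Fin n => range (N + 1), r ^ wt k :=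
        sum_le_sum_of_subset_of_nonneg hsub fun _ _ _ => by positivity
    _ = ∏ _i : Fin n, ∑ j ∈ range (N + 1), r ^ j := by
        rw [prod_univ_sum]
        exact sum_congr rfl fun k _ => (prod_pow_eq_pow_sum _ _ _).symm
    _ ≤ _ := by
        refine prod_le_prod (fun _ _ => sum_nonneg fun _ _ => by positivity) fun _ _ => ?_
        rw [← tsum_geometric_of_lt_one hr0 hr1]
        exact (summable_geometric_of_lt_one hr0 hr1).sum_le_tsum _ fun _ _ => by positivity

theorem hasSum_outerTerm (hq0 : q ≠ 0) (hq1 : ‖q‖ < 1) {α b c d β γ : ℂ}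
    {a x : Fin n → ℂ} (ha : ∀ r, a r ≠ 0)
    (hx : ∀ r, x r ≠ 0) (hxx : ∀ r s, r < s → 1 - x r / x s ≠ 0)
    (hxq : ∀ (r s : Fin n) (k : ℕ), qPoch q (q * x r / x s) k ≠ 0)
    (hs : Summable fun k : Fin n → ℕ => outerTerm q α b c d β γ a x k) :
    HasSum (fun k : Fin n → ℕ => outerTerm q α b c d β γ a x k)
      (∑' K, expansionTerm q α (coeffSeq q (α * β) (α * γ) (α * b) (α * c) (α * d))
        ((∏ r, a r) / q ^ n) K) := by
  have h1 := hs.hasSum.tsum_fiberwise wt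
  have h2 : ∀ K, ∑' k : wt (n := n) ⁻¹' {K}, outerTerm q α b c d β γ a x k
      = expansionTerm q α (coeffSeq q (α * β) (α * γ) (α * b) (α * c) (α * d))
        ((∏ r, a r) / q ^ n) K := by
    intro K
    rw [← sum_outerTerm_eq_expansionTerm hq0 hq1 α b c d β γ ha hx hxx hxq K, ← Finset.tsum_subtype]
    have : wt (n := n) ⁻¹' {K} = ((piAntidiag univ K : Finset (Fin n → ℕ)) : Set (Fin n → ℕ)) := by
      ext k
      simp [wt]
    rw [this]
    rfl
  rw [← tsum_congr h2, h1.tsum_eq]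
  exact hs.hasSum

/-- The `A_n` factors are bounded and the rest is `O(r^{|k|})` for some `r < 1`. -/
theorem summable_outerTerm (hq0 : q ≠ 0) (hq1 : ‖q‖ < 1) {α b c d β γ : ℂ}
    {a x : Fin n → ℂ}
    (hx : ∀ r, x r ≠ 0) (hxx : ∀ r s, r < s → 1 - x r / x s ≠ 0)
    (hxq : ∀ (r s : Fin n) (k : ℕ), qPoch q (q * x r / x s) k ≠ 0)
    (hαa : qPochInf q (α * q * ((∏ r, a r) / q ^ n)) ≠ 0)
    (hαb : qPochInf q (α * b) ≠ 0) (hαc : qPochInf q (α * c) ≠ 0) (hαd : qPochInf q (α * d) ≠ 0)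
    (hβ : ‖α * β * ((∏ r, a r) / q ^ n)‖ < 1) (hγ : ‖α * γ * ((∏ r, a r) / q ^ n)‖ < 1) :
    Summable fun k : Fin n → ℕ => outerTerm q α b c d β γ a x k := by
  obtain ⟨C, r, hr0, hr1, hC⟩ := exists_norm_expansionTerm_le (α := α) hq0 hq1 hαb hαc hαd hβ hγ
  obtain ⟨T, hT0, hT⟩ := exists_norm_milneTerm_le hq0 hq1 x (fun s => q / a s) hxq
  obtain ⟨B, hB0, hB⟩ := exists_norm_inv_qPoch_le hq1 hαa
  refine .of_norm_bounded (((summable_pow_wt hr0 hr1).mul_left (T * ((1 + ‖α‖)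
    * Real.exp (‖α‖ * (1 - ‖q‖)⁻¹) * (‖(1 - α)⁻¹‖ * B) * C)))) fun k => ?_
  rw [outerTerm_eq hq0 hq1 α b c d β γ hx hxx hxq, norm_mul, mul_assoc T, mul_assoc _ C]
  refine mul_le_mul (hT k) ?_ (norm_nonneg _) hT0.le
  rw [norm_mul]
  refine mul_le_mul ?_ (hC _) (norm_nonneg _) (by positivity)
  rw [div_eq_mul_inv, mul_inv, norm_mul, norm_mul, norm_mul]
  have h1 : ‖1 - α * q ^ (2 * wt k)‖ ≤ 1 + ‖α‖ := by
    refine (norm_sub_le _ _).trans ?_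
    rw [norm_one, norm_mul, norm_pow]
    gcongr
    exact mul_le_of_le_one_right (norm_nonneg α) (pow_le_one₀ (norm_nonneg q) hq1.le)
  gcongr
  exacts [norm_qPoch_le hq1 le_rfl _, hB _]

theorem tsum_expansionTerm_pow_coeffSeq (hq0 : q ≠ 0) (hq1 : ‖q‖ < 1) {α u v b c d : ℂ} (L : ℕ)
    (hα : 1 - α ≠ 0) (hb : qPochInf q b ≠ 0) (hc : qPochInf q c ≠ 0) (hd : qPochInf q d ≠ 0)
    (hu : qPochInf q (u * q ^ L) ≠ 0) (hv : qPochInf q (v * q ^ L) ≠ 0)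
    (hαz : qPochInf q (α * q * q ^ L) ≠ 0) :
    ∑' k, expansionTerm q α (coeffSeq q u v b c d) (q ^ L) k
      = qPochInf q (α * q) / qPochInf q (α * q * q ^ L)
        * (qPochInf q u * qPochInf q v / (qPochInf q b * qPochInf q c * qPochInf q d)
          * (qPochInf q (b * q ^ L) * qPochInf q (c * q ^ L) * qPochInf q (d * q ^ L)
            / (qPochInf q (u * q ^ L) * qPochInf q (v * q ^ L)))) := by
  rw [tsum_eq_sum (s := range (L + 1)) fun k hk =>
      expansionTerm_eq_zero q α _ (by rw [mem_range] at hk; omega),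
    sum_expansionTerm_pow hq0 hq1 hα _ L hαz, coeffSeq_eq hq1 hb hc hd hu hv,
    qPochInf_eq_mul hq1 (α * q) L, mul_div_cancel_right₀ _ hαz]

end Main

theorem mainTheorem4 {n : ℕ} (q α b c d β γ : ℂ) (a x : Fin n → ℂ)
    (hq0 : 0 < ‖q‖) (hq1 : ‖q‖ < 1)
    -- none of the denominators vanishes
    (ha : ∀ r, a r ≠ 0) (hx : ∀ r, x r ≠ 0)
    (hxx : ∀ r s, r < s → 1 - x r / x s ≠ 0)
    (hxq : ∀ (r s : Fin n) (k : ℕ), qPoch q (q * x r / x s) k ≠ 0)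
    (hα : 1 - α ≠ 0)
    (hαa : qPochInf q (α * (∏ r, a r) * q ^ (1 - (n : ℤ))) ≠ 0)
    (hαb : qPochInf q (α * b) ≠ 0) (hαc : qPochInf q (α * c) ≠ 0)
    (hαd : qPochInf q (α * d) ≠ 0)
    (hαβ : qPochInf q (α * β * (∏ r, a r) / q ^ n) ≠ 0)
    (hαγ : qPochInf q (α * γ * (∏ r, a r) / q ^ n) ≠ 0)
    -- convergence, or termination
    (hconv : (‖(∏ r, a r) / q ^ n‖ < 1 ∧ ‖α * β * (∏ r, a r) / q ^ n‖ < 1 ∧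
          ‖α * γ * (∏ r, a r) / q ^ n‖ < 1) ∨
        ∃ N : Fin n → ℕ, ∀ r, 1 ≤ N r ∧ a r = q ^ N r) :
    HasSum (fun k : Fin n → ℕ => outerTerm q α b c d β γ a x k)
      (productSide q α b c d β γ a) := by
  have hq0 : q ≠ 0 := norm_pos_iff.1 hq0
  set z := (∏ r, a r) / q ^ n with hz
  have e1 : α * (∏ r, a r) * q ^ (1 - (n : ℤ)) = α * q * z := by
    rw [zpow_sub₀ hq0, zpow_one, zpow_natCast]; ring
  have e2 : ∀ w, α * w * (∏ r, a r) / q ^ n = α * w * z := fun w => mul_div_assoc _ _ _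
  have e3 : ∀ w, α * (∏ r, a r) * w / q ^ n = α * w * z := fun w => by rw [hz]; ring
  have hprod : productSide q α b c d β γ a
      = qPochInf q (α * q) / qPochInf q (α * q * z)
        * (qPochInf q (α * β) * qPochInf q (α * γ)
            / (qPochInf q (α * b) * qPochInf q (α * c) * qPochInf q (α * d))
          * (qPochInf q (α * b * z) * qPochInf q (α * c * z) * qPochInf q (α * d * z)
            / (qPochInf q (α * β * z) * qPochInf q (α * γ * z)))) := by
    rw [productSide, e1, e2, e2, e3, e3, e3]
    simp only [div_eq_mul_inv, mul_inv]
    ring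
  rw [e1] at hαa
  rw [e2] at hαβ hαγ
  rw [hprod]
  rcases hconv with ⟨-, hβ, hγ⟩ | ⟨N, hN⟩
  · rw [e2] at hβ hγ
    rw [← tsum_expansionTerm_coeffSeq hq0 hq1 hα hαb hαc hαd hβ hγ hαa]
    exact hasSum_outerTerm hq0 hq1 ha hx hxx hxq
      (summable_outerTerm hq0 hq1 hx hxx hxq hαa hαb hαc hαd hβ hγ)
  -- Since `N_r ≥ 1`, dividing by `q^n` lowers each exponent by one and leaves a natural number.
  · have hzL : z = q ^ (∑ r, (N r - 1)) := by
      have h1 : ∏ r, a r = q ^ (∑ r, (N r - 1)) * q ^ n := by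
        rw [prod_congr rfl fun r _ => (hN r).2, prod_pow_eq_pow_sum, ← pow_add]
        congr 1
        have h2 : ∀ r ∈ (univ : Finset (Fin n)), N r = (N r - 1) + 1 := fun r _ => by
          have := (hN r).1
          omega
        rw [sum_congr rfl h2, sum_add_distrib]
        simp
      rw [hz, h1, mul_div_cancel_right₀ _ (pow_ne_zero n hq0)]
    have hs : Summable fun k : Fin n → ℕ => outerTerm q α b c d β γ a x k := by
      refine summable_of_ne_finset_zero (s := Fintype.piFinset fun r => range (N r)) fun k hk => ?_
      rw [Fintype.mem_piFinset] at hk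
      push Not at hk
      obtain ⟨r, hr⟩ := hk
      have h0 : qPoch q (q / a r) (k r) = 0 := by
        obtain ⟨h1, h2⟩ := hN r
        rw [mem_range] at hr
        -- The factor of index `N_r - 1` in `(q^{1-N_r})_{k_r}` is zero.
        refine prod_eq_zero (mem_range.2 (show N r - 1 < k r by omega)) ?_
        obtain ⟨M, hM⟩ := Nat.exists_eq_add_of_le' h1
        rw [h2, hM, Nat.add_sub_cancel, pow_succ]
        field_simp
        ring
      rw [outerTerm_eq hq0 hq1 α b c d β γ hx hxx hxq, milneTerm_eq_zero (x := x) (c := fun s => q / a s) (m := k) r (hx r) h0, zero_mul]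
    have h := hasSum_outerTerm hq0 hq1 ha hx hxx hxq hs
    rw [← hz, hzL] at h
    rw [hzL] at hαa hαβ hαγ ⊢
    rwa [tsum_expansionTerm_pow_coeffSeq hq0 hq1 _ hα hαb hαc hαd hαβ hαγ hαa] at h
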